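/- An orbifold $\mathcal O$ on the Riemann sphere $\mathbb{CP}^1$ is a function $\nu:\mathbb{CP}^1\to\{1,2,3,\dots\}$ that equals $1$ outside a finite set. Its singular points are the $z$ with $\nu(z)>1$, and its signature $\nu(\mathcal O)$ is the multiset of values of $\nu$ at the singular points. $\mathcal O$ is good if it has neither exactly one singular point nor exactly two singular points with different values of $\nu$. For a nonconstant rational function $f$ let $\deg_z f$ be its local degree at $z$. For orbifolds $\mathcal O_1,\mathcal O_2$ with ramification functions $\nu_1,\nu_2$, call $f:\mathcal O_1\to\mathcal O_2$ a minimal holomorphic map if $$\nu_2(f(z))=\nu_1(z)\,\gcd\bigl(\deg_z f,\ \nu_2(f(z))\bigr)\qquad\text{for all } z\in\mathbb{CP}^1 .$$ Let $f^*\mathcal O$ be the unique orbifold for which $f:f^*\mathcal O\to\mathcal O$ is a minimal holomorphic map, and let $\mathcal E(\mathcal O)$ be the set of nonconstant rational functions $A$ such that $A:\mathcal O\to\mathcal O$ is a minimal holomorphic map. Theorem. Let $\mathcal O$ be a good orbifold on $\mathbb{CP}^1$. (1) If $U,V\in\mathcal E(\mathcal O)$, then $U\circ V\in\mathcal E(\mathcal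 O)$. (2) Let $U,V$ be rational functions of degree at least two with $U\circ V\in\mathcal E(\mathcal O)$. Then $\nu(U^*\mathcal O)=\nu(\mathcal O)$, and $V:\mathcal O\to U^*\mathcal O$ and $U:U^*\mathcal O\to\mathcal O$ are minimal holomorphic maps. Moreover, if $\nu(\mathcal O)\neq\{2,2,2,2\}$, then there exists a Möbius transformation $\mu$ such that $U\circ\mu$ and $\mu^{-1}\circ V$ both belong to $\mathcal E(\mathcal O)$. -/

import Mathlib

open Polynomial

noncomputable section

/-- The Riemann sphere, `ℂ ∪ {∞}`. -/
abbrev Sphere : Type := OnePoint ℂ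

/-! Rational functions are elements `f` of `ℂ(z)`, written in lowest terms as
`f.num / f.denom`. -/
namespace RatMap

/-- The degree of a rational function, the maximum of the degrees of its numerator and its
denominator in lowest terms. It is zero exactly for the constants. -/
def deg (f : RatFunc ℂ) : ℕ := max f.num.natDegree f.denom.natDegree

open Classical in
/-- The value of a rational function at a point of the Riemann sphere. -/
def val (f : RatFunc ℂ) : Sphere → Sphere
  | some a =>
      if f.denom.eval a = 0 then OnePoint.infty
      else ((f.num.eval a / f.denom.eval a : ℂ) : Sphere)
  | none =>
      if f.denom.natDegree < f.num.natDegree then OnePoint.infty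
      else ((f.num.coeff f.denom.natDegree / f.denom.leadingCoeff : ℂ) : Sphere)

/-- The polynomial whose finite roots are the finite solutions of `f = w`, with the same
multiplicities: `f.num - w * f.denom` for finite `w`, and `f.denom` for `w = ∞`. -/
def fiberPoly (f : RatFunc ℂ) : Sphere → ℂ[X]
  | some w => f.num - C w * f.denom
  | none => f.denom

/-- The local degree of a nonconstant rational function `f` at `z`: the multiplicity of `z` as a
solution of the equation `f = f(z)`. At `z = ∞` it is the number of the `deg f` solutions,
counted with multiplicity, that are not finite. -/
def localDeg (f : RatFunc ℂ) : Sphere → ℕ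
  | some a => (fiberPoly f (val f (some a))).rootMultiplicity a
  | none => deg f - (fiberPoly f (val f none)).natDegree

/-- The composition `U ∘ V` (for nonconstant `V`): `V` is substituted for the variable of `U`. -/
def comp (U V : RatFunc ℂ) : RatFunc ℂ := RatFunc.eval RatFunc.C V U

/-- The Möbius transformation `z ↦ (a z + b) / (c z + d)` of an invertible matrix. -/
def moebius (M : GL (Fin 2) ℂ) : RatFunc ℂ :=
  (RatFunc.C (M 0 0) * RatFunc.X + RatFunc.C (M 0 1)) /
    (RatFunc.C (M 1 0) * RatFunc.X + RatFunc.C (M 1 1))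

end RatMap

/-- An orbifold on the Riemann sphere: a function with positive integer values that is equal
to `1` outside a finite set. -/
structure SphereOrbifold where
  /-- The ramification function. -/
  ν : Sphere → ℕ
  one_le : ∀ z, 1 ≤ ν z
  finite : {z | 1 < ν z}.Finite

namespace SphereOrbifold

/-- The set of singular points. -/
def sing (O : SphereOrbifold) : Set Sphere := {z | 1 < O.ν z}

/-- The signature: the multiset of the values of `ν` at the singular points. -/
def signature (O : SphereOrbifold) : Multiset ℕ := O.finite.toFinset.val.map O.ν

/-- An orbifold is good if it has neither exactly one singular point, nor exactly two singular
points with different values of the ramification function. -/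
def IsGood (O : SphereOrbifold) : Prop :=
  (∀ z, O.sing ≠ {z}) ∧ ∀ z₁ z₂, z₁ ≠ z₂ → O.sing = {z₁, z₂} → O.ν z₁ = O.ν z₂

/-- The nonconstant rational function `f` is a minimal holomorphic map `O₁ → O₂`. -/
def IsMinimal (f : RatFunc ℂ) (O₁ O₂ : SphereOrbifold) : Prop :=
  0 < RatMap.deg f ∧
    ∀ z, O₂.ν (RatMap.val f z) =
      O₁.ν z * Nat.gcd (RatMap.localDeg f z) (O₂.ν (RatMap.val f z))

/-- The set of rational functions that are minimal holomorphic maps `O → O`. -/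
def minimalSelfMaps (O : SphereOrbifold) : Set (RatFunc ℂ) := {A | IsMinimal A O O}

theorem pullback_finite (f : RatFunc ℂ) (O : SphereOrbifold) :
    {z | 1 < O.ν (RatMap.val f z) /
      Nat.gcd (RatMap.localDeg f z) (O.ν (RatMap.val f z))}.Finite := by
  have key : ∀ w : Sphere, {z | RatMap.val f z = w ∧ 1 < O.ν (RatMap.val f z) /
      Nat.gcd (RatMap.localDeg f z) (O.ν (RatMap.val f z))}.Finite := by
    intro w
    by_cases hw : RatMap.fiberPoly f w = 0
    · convert Set.finite_singleton (OnePoint.infty : Sphere) |>.subset ?_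
      rintro z ⟨hz, h⟩
      induction z using OnePoint.rec with
      | infty => rfl
      | coe a =>
        exfalso
        have : RatMap.localDeg f (a : Sphere) = 0 := by
          change (RatMap.fiberPoly f (RatMap.val f (a : Sphere))).rootMultiplicity a = 0
          rw [hz, hw, Polynomial.rootMultiplicity_zero]
        rw [this, Nat.gcd_zero_left, Nat.div_self (O.one_le _)] at h
        omega
    · refine (((RatMap.fiberPoly f w).roots.toFinset.finite_toSet.image
        (fun a : ℂ => (a : Sphere))).union (Set.finite_singleton OnePoint.infty)).subset ?_
      rintro z ⟨hz, -⟩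
      induction z using OnePoint.rec with
      | infty => right; rfl
      | coe a =>
        left
        refine ⟨a, ?_, rfl⟩
        simp only [Finset.mem_coe, Multiset.mem_toFinset, Polynomial.mem_roots hw,
          Polynomial.IsRoot.def]
        subst hz
        change (RatMap.fiberPoly f (if f.denom.eval a = 0 then OnePoint.infty
          else ((f.num.eval a / f.denom.eval a : ℂ) : Sphere))).eval a = 0
        split_ifs with hd
        · exact hd
        · change (f.num - C (f.num.eval a / f.denom.eval a) * f.denom).eval a = 0
          simp [hd]
  refine (O.finite.biUnion fun w _ => key w).subset ?_
  intro z hz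
  simp only [Set.mem_iUnion]
  refine ⟨RatMap.val f z, ?_, rfl, hz⟩
  exact lt_of_lt_of_le hz (Nat.div_le_self _ _)

/-- The pullback orbifold `f^* O`, the unique one for which the nonconstant rational function `f`
is a minimal holomorphic map `f^* O → O`. The division is exact. -/
def pullback (f : RatFunc ℂ) (O : SphereOrbifold) : SphereOrbifold where
  ν z := O.ν (RatMap.val f z) / Nat.gcd (RatMap.localDeg f z) (O.ν (RatMap.val f z))
  one_le _ := Nat.div_pos (Nat.gcd_le_right _ (O.one_le _)) (Nat.gcd_pos_of_pos_right _ (O.one_le _))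
  finite := pullback_finite f O

end SphereOrbifold

end

/-!
The sphere is treated algebraically. A rational function `f` has a value `c` at a point `z` when it
is a quotient of polynomials for which this can be read off (`RatMap.HasValue`), and its local
degree is the order of vanishing of `f - f(z)`, or of `1 / f` at a pole, in a local parameter
(`RatMap.hasOrder_localDeg`). Substitution carries a local parameter at `V(z)` to a power of the
local parameter at `z` times a unit, so local degrees multiply (`RatMap.localDeg_comp`). With an
identity between greatest common divisors this gives closure under composition
(`SphereOrbifold.IsMinimal.comp`) and shows that a minimal map `U ∘ V : O → O` factors into minimal
maps `V : O → U^*O` and `U : U^*O → O` (`SphereOrbifold.IsMinimal.of_comp`).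

It remains to see that `U^*O` and `O` have the same signature. The zeros of the Wronskian of the
numerator and the denominator bound the ramification of `f` (`RatMap.sum_localDeg_sub_one_le`), and
this yields `χ(O₁) ≤ deg f * χ(O₂)` for a minimal map `f : O₁ → O₂`
(`SphereOrbifold.IsMinimal.eulerChar_le`). Applied to `U` and `V`, it shows that `χ(O)` and
`χ(U^*O)` are both zero or both positive, which leaves few types of signatures
(`SphereOrbifold.signature_classification`). Those possible for `U^*O` include bad orbifolds, and
the Euler characteristic does not exclude them. They are excluded by congruences: over a point `w`
with `p ∣ ν₂ w` the local degree is prime to `p` exactly where `ν₁` has the `p`-adic valuation of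
`ν₂ w`, so the degree of `f` modulo the prime `p` is determined by the singular points over `w`
(`SphereOrbifold.IsMinimal.deg_modEq`). Two consequences which mention only the signatures,
`SphereOrbifold.IsMinimal.countVal_le` and `SphereOrbifold.IsMinimal.countVal_two_modEq`, together
with mutual divisibility of the entries, force equality (`SphereOrbifold.SignatureMap.eq`).

Unless the signature is `{2, 2, 2, 2}`, there are at most three singular points, so some Möbius
transformation is an isomorphism from `O` to `U^*O`
(`SphereOrbifold.exists_smul_of_signature_eq`), and composing with it and with its inverse proves
the last claim.
-/

namespace RatMap

/-! ### Values of rational functions at points of the sphere -/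

/-- The rational function `f` is regular at the point `z` of the sphere, with value `c`: it is a
quotient of polynomials `p / q`, not necessarily in lowest terms, with `q` nonzero at `z` and
`p = c q` there. At `∞` the polynomials are compared through their coefficients at the degree
of `q`. -/
def HasValue : Sphere → RatFunc ℂ → ℂ → Prop
  | some a, f, c => ∃ p q : ℂ[X], q.eval a ≠ 0 ∧
      f = algebraMap ℂ[X] (RatFunc ℂ) p / algebraMap ℂ[X] (RatFunc ℂ) q ∧ p.eval a = c * q.eval a
  | none, f, c => ∃ p q : ℂ[X], q ≠ 0 ∧
      f = algebraMap ℂ[X] (RatFunc ℂ) p / algebraMap ℂ[X] (RatFunc ℂ) q ∧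
      p.natDegree ≤ q.natDegree ∧ p.coeff q.natDegree = c * q.leadingCoeff

theorem hasValue_coe {a : ℂ} {f : RatFunc ℂ} {c : ℂ} : HasValue (a : Sphere) f c ↔
    ∃ p q : ℂ[X], q.eval a ≠ 0 ∧
      f = algebraMap ℂ[X] (RatFunc ℂ) p / algebraMap ℂ[X] (RatFunc ℂ) q ∧
      p.eval a = c * q.eval a := Iff.rfl

theorem hasValue_infty {f : RatFunc ℂ} {c : ℂ} : HasValue OnePoint.infty f c ↔
    ∃ p q : ℂ[X], q ≠ 0 ∧
      f = algebraMap ℂ[X] (RatFunc ℂ) p / algebraMap ℂ[X] (RatFunc ℂ) q ∧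
      p.natDegree ≤ q.natDegree ∧ p.coeff q.natDegree = c * q.leadingCoeff := Iff.rfl

theorem ne_zero_of_eval_ne_zero {q : ℂ[X]} {a : ℂ} (h : q.eval a ≠ 0) : q ≠ 0 := by
  rintro rfl
  simp at h

theorem hasValue_C (z : Sphere) (c : ℂ) : HasValue z (RatFunc.C c) c := by
  induction z using OnePoint.rec with
  | infty => exact ⟨C c, 1, one_ne_zero, by simp, by simp, by simp⟩
  | coe a => exact ⟨C c, 1, by simp, by simp, by simp⟩

theorem HasValue.add {z : Sphere} {f g : RatFunc ℂ} {c d : ℂ} (hf : HasValue z f c)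
    (hg : HasValue z g d) : HasValue z (f + g) (c + d) := by
  induction z using OnePoint.rec with
  | infty =>
    obtain ⟨p, q, hq, rfl, hpq, hc⟩ := hf
    obtain ⟨p', q', hq', rfl, hpq', hc'⟩ := hg
    refine ⟨p * q' + q * p', q * q', mul_ne_zero hq hq', ?_, ?_, ?_⟩
    · rw [div_add_div _ _ (RatFunc.algebraMap_ne_zero hq) (RatFunc.algebraMap_ne_zero hq')]
      simp
    · rw [natDegree_mul hq hq']
      exact natDegree_add_le_of_degree_le (natDegree_mul_le_of_le hpq le_rfl)
        (natDegree_mul_le_of_le le_rfl hpq')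
    · rw [natDegree_mul hq hq', coeff_add, coeff_mul_add_eq_of_natDegree_le hpq le_rfl,
        coeff_mul_add_eq_of_natDegree_le le_rfl hpq', hc, hc', leadingCoeff_mul]
      simp only [coeff_natDegree]
      ring
  | coe a =>
    obtain ⟨p, q, hq, rfl, hc⟩ := hf
    obtain ⟨p', q', hq', rfl, hc'⟩ := hg
    refine ⟨p * q' + q * p', q * q', by simp [hq, hq'], ?_, ?_⟩
    · rw [div_add_div _ _ (RatFunc.algebraMap_ne_zero (ne_zero_of_eval_ne_zero hq))
        (RatFunc.algebraMap_ne_zero (ne_zero_of_eval_ne_zero hq'))]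
      simp
    · simp only [eval_add, eval_mul, hc, hc']
      ring

theorem HasValue.mul {z : Sphere} {f g : RatFunc ℂ} {c d : ℂ} (hf : HasValue z f c)
    (hg : HasValue z g d) : HasValue z (f * g) (c * d) := by
  induction z using OnePoint.rec with
  | infty =>
    obtain ⟨p, q, hq, rfl, hpq, hc⟩ := hf
    obtain ⟨p', q', hq', rfl, hpq', hc'⟩ := hg
    refine ⟨p * p', q * q', mul_ne_zero hq hq', ?_, ?_, ?_⟩
    · rw [div_mul_div_comm]
      simp
    · rw [natDegree_mul hq hq']
      exact natDegree_mul_le_of_le hpq hpq'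
    · rw [natDegree_mul hq hq', coeff_mul_add_eq_of_natDegree_le hpq hpq', hc, hc',
        leadingCoeff_mul]
      ring
  | coe a =>
    obtain ⟨p, q, hq, rfl, hc⟩ := hf
    obtain ⟨p', q', hq', rfl, hc'⟩ := hg
    refine ⟨p * p', q * q', by simp [hq, hq'], ?_, ?_⟩
    · rw [div_mul_div_comm]
      simp
    · simp only [eval_mul, hc, hc']
      ring

theorem HasValue.inv {z : Sphere} {f : RatFunc ℂ} {c : ℂ} (hf : HasValue z f c) (hc0 : c ≠ 0) :
    HasValue z f⁻¹ c⁻¹ := by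
  induction z using OnePoint.rec with
  | infty =>
    obtain ⟨p, q, hq, rfl, hpq, hc⟩ := hf
    have hne : p.coeff q.natDegree ≠ 0 := by
      rw [hc]
      exact mul_ne_zero hc0 (leadingCoeff_ne_zero.mpr hq)
    have hdeg : p.natDegree = q.natDegree := le_antisymm hpq (le_natDegree_of_ne_zero hne)
    refine ⟨q, p, ?_, by rw [inv_div], hdeg.ge, ?_⟩
    · rintro rfl
      simp at hne
    · rw [leadingCoeff, hdeg, hc, coeff_natDegree]
      field_simp
  | coe a =>
    obtain ⟨p, q, hq, rfl, hc⟩ := hf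
    refine ⟨q, p, ?_, by rw [inv_div], ?_⟩
    · rw [hc]
      exact mul_ne_zero hc0 hq
    · rw [hc]
      field_simp

theorem HasValue.unique {z : Sphere} {f : RatFunc ℂ} {c d : ℂ} (hf : HasValue z f c)
    (hg : HasValue z f d) : c = d := by
  induction z using OnePoint.rec with
  | infty =>
    obtain ⟨p, q, hq, rfl, hpq, hc⟩ := hf
    obtain ⟨p', q', hq', h, hpq', hc'⟩ := hg
    rw [div_eq_div_iff (RatFunc.algebraMap_ne_zero hq) (RatFunc.algebraMap_ne_zero hq'),
      ← map_mul, ← map_mul, (RatFunc.algebraMap_injective ℂ).eq_iff] at h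
    have h' := congrArg (fun r => r.coeff (q.natDegree + q'.natDegree)) h
    beta_reduce at h'
    rw [coeff_mul_add_eq_of_natDegree_le hpq le_rfl, add_comm,
      coeff_mul_add_eq_of_natDegree_le hpq' le_rfl, hc, hc', coeff_natDegree, coeff_natDegree] at h'
    have h1 := leadingCoeff_ne_zero.mpr hq
    have h2 := leadingCoeff_ne_zero.mpr hq'
    apply mul_right_cancel₀ (mul_ne_zero h1 h2)
    linear_combination h'
  | coe a =>
    obtain ⟨p, q, hq, rfl, hc⟩ := hf
    obtain ⟨p', q', hq', h, hc'⟩ := hg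
    rw [div_eq_div_iff (RatFunc.algebraMap_ne_zero (ne_zero_of_eval_ne_zero hq))
      (RatFunc.algebraMap_ne_zero (ne_zero_of_eval_ne_zero hq')),
      ← map_mul, ← map_mul, (RatFunc.algebraMap_injective ℂ).eq_iff] at h
    have h' := congrArg (eval a) h
    rw [eval_mul, eval_mul, hc, hc'] at h'
    apply mul_right_cancel₀ (mul_ne_zero hq hq')
    linear_combination h'

theorem HasValue.pow {z : Sphere} {f : RatFunc ℂ} {c : ℂ} (hf : HasValue z f c) (n : ℕ) :
    HasValue z (f ^ n) (c ^ n) := by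
  induction n with
  | zero => simpa using hasValue_C z 1
  | succ n ih => simpa only [pow_succ] using ih.mul hf

theorem HasValue.aeval {z : Sphere} {f : RatFunc ℂ} {c : ℂ} (hf : HasValue z f c) (p : ℂ[X]) :
    HasValue z (aeval f p) (p.eval c) := by
  induction p using Polynomial.induction_on' with
  | add p q hp hq => simpa using hp.add hq
  | monomial n a =>
    simpa [aeval_monomial, RatFunc.algebraMap_eq_C] using (hasValue_C z a).mul (hf.pow n)

theorem num_eval_ne_zero {f : RatFunc ℂ} {a : ℂ} (h : f.denom.eval a = 0) :
    f.num.eval a ≠ 0 := by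
  obtain ⟨u, v, huv⟩ := f.isCoprime_num_denom
  intro h0
  have := congrArg (eval a) huv
  simp [h0, h] at this

theorem val_infty (f : RatFunc ℂ) : val f OnePoint.infty =
    if f.denom.natDegree < f.num.natDegree then OnePoint.infty
    else ((f.num.coeff f.denom.natDegree / f.denom.leadingCoeff : ℂ) : Sphere) := rfl

open Classical in
theorem val_coe (f : RatFunc ℂ) (a : ℂ) : val f (a : Sphere) =
    if f.denom.eval a = 0 then OnePoint.infty
    else ((f.num.eval a / f.denom.eval a : ℂ) : Sphere) := rfl

/-- The value of a rational function is its value in the sense of `HasValue`, and it is `∞`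
where the inverse function vanishes. -/
theorem val_spec (f : RatFunc ℂ) (z : Sphere) :
    (∃ c : ℂ, val f z = c ∧ HasValue z f c) ∨
      (val f z = OnePoint.infty ∧ f ≠ 0 ∧ HasValue z f⁻¹ 0) := by
  have hd := f.denom_ne_zero
  induction z using OnePoint.rec with
  | infty =>
    rw [val_infty]
    split_ifs with h
    · have hn : f.num ≠ 0 := by
        intro h0
        simp [h0] at h
      refine Or.inr ⟨rfl, fun h0 => hn (by simp [h0]), f.denom, f.num, hn, ?_, h.le, ?_⟩
      · conv_lhs => rw [← f.num_div_denom]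
        rw [inv_div]
      · rw [zero_mul, coeff_eq_zero_of_natDegree_lt h]
    · refine Or.inl ⟨_, rfl, f.num, f.denom, hd, f.num_div_denom.symm, not_lt.mp h, ?_⟩
      rw [div_mul_cancel₀ _ (leadingCoeff_ne_zero.mpr hd)]
  | coe a =>
    rw [val_coe]
    split_ifs with h
    · have hn := num_eval_ne_zero h
      refine Or.inr ⟨rfl, fun h0 => hn (by simp [h0]), f.denom, f.num, hn, ?_, by simp [h]⟩
      conv_lhs => rw [← f.num_div_denom]
      rw [inv_div]
    · exact Or.inl ⟨_, rfl, f.num, f.denom, h, f.num_div_denom.symm, (div_mul_cancel₀ _ h).symm⟩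

theorem not_hasValue_of_inv {z : Sphere} {f : RatFunc ℂ} {c : ℂ} (hf0 : f ≠ 0)
    (h : HasValue z f⁻¹ 0) : ¬ HasValue z f c := by
  intro hf
  have h1 := hf.mul h
  rw [mul_inv_cancel₀ hf0, mul_zero] at h1
  exact zero_ne_one (h1.unique (by simpa using hasValue_C z 1))

theorem HasValue.val_eq {z : Sphere} {f : RatFunc ℂ} {c : ℂ} (hf : HasValue z f c) :
    val f z = c := by
  rcases val_spec f z with ⟨d, hd, h⟩ | ⟨-, h0, h⟩
  · rw [hd, hf.unique h]
  · exact absurd hf (not_hasValue_of_inv h0 h)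

theorem val_eq_infty {z : Sphere} {f : RatFunc ℂ} (h0 : f ≠ 0) (hf : HasValue z f⁻¹ 0) :
    val f z = OnePoint.infty := by
  rcases val_spec f z with ⟨d, hd, h⟩ | ⟨h, -⟩
  · exact absurd h (not_hasValue_of_inv h0 hf)
  · exact h

/-! ### Composition -/

theorem deg_eq_zero_iff (f : RatFunc ℂ) : deg f = 0 ↔ ∃ c, f = RatFunc.C c := by
  rw [RatFunc.eq_C_iff, deg]
  omega

theorem aeval_ne_zero {V : RatFunc ℂ} (hV : 0 < deg V) {p : ℂ[X]} (hp : p ≠ 0) :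
    aeval V p ≠ 0 := by
  have h : Transcendental ℂ V :=
    V.transcendental_of_ne_C fun h => hV.ne' ((deg_eq_zero_iff V).mpr h)
  exact fun h0 => hp (transcendental_iff.mp h p h0)

/-- Substitution of a nonconstant rational function `V` for the variable, as an endomorphism of
`ℂ(z)`. -/
noncomputable def compHom (V : RatFunc ℂ) (hV : 0 < deg V) : RatFunc ℂ →ₐ[ℂ] RatFunc ℂ :=
  RatFunc.liftAlgHom (aeval V) fun _ hp => mem_nonZeroDivisors_of_ne_zero
    (aeval_ne_zero hV (nonZeroDivisors.ne_zero hp))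

theorem compHom_div (V : RatFunc ℂ) (hV : 0 < deg V) (p q : ℂ[X]) :
    compHom V hV (algebraMap ℂ[X] (RatFunc ℂ) p / algebraMap ℂ[X] (RatFunc ℂ) q) =
      aeval V p / aeval V q :=
  RatFunc.liftAlgHom_apply_div _ _ _ _

theorem comp_eq_compHom (U V : RatFunc ℂ) (hV : 0 < deg V) : comp U V = compHom V hV U := by
  conv_rhs => rw [← U.num_div_denom]
  rw [compHom_div]
  rfl

theorem compHom_C (V : RatFunc ℂ) (hV : 0 < deg V) (c : ℂ) :
    compHom V hV (RatFunc.C c) = RatFunc.C c := by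
  rw [← RatFunc.algebraMap_eq_C]
  exact (compHom V hV).commutes c

theorem compHom_X (V : RatFunc ℂ) (hV : 0 < deg V) : compHom V hV RatFunc.X = V := by
  rw [← comp_eq_compHom, comp, RatFunc.eval_X]

theorem deg_comp_pos {U V : RatFunc ℂ} (hU : 0 < deg U) (hV : 0 < deg V) : 0 < deg (comp U V) := by
  refine Nat.pos_of_ne_zero fun h => hU.ne' ?_
  rw [deg_eq_zero_iff] at h ⊢
  obtain ⟨c, hc⟩ := h
  rw [comp_eq_compHom U V hV, ← compHom_C V hV] at hc
  exact ⟨c, (compHom V hV).injective hc⟩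

/-- Substituting `V` into a function regular at `V(z)` gives a function regular at `z`, with the
same value. -/
theorem HasValue.compHom {V : RatFunc ℂ} (hV : 0 < deg V) {z : Sphere} {u : RatFunc ℂ} {c : ℂ}
    (hu : HasValue (val V z) u c) : HasValue z (compHom V hV u) c := by
  rcases val_spec V z with ⟨b, hb, h⟩ | ⟨hb, h0, h⟩
  · rw [hb] at hu
    obtain ⟨p, q, hq, rfl, hc⟩ := hu
    rw [compHom_div, div_eq_mul_inv]
    have h1 := (h.aeval p).mul ((h.aeval q).inv hq)
    rwa [hc, mul_assoc, mul_inv_cancel₀ hq, mul_one] at h1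
  · rw [hb] at hu
    obtain ⟨p, q, hq, rfl, hpq, hc⟩ := hu
    -- near a pole of `V`, polynomials in `V` are rewritten as polynomials in `1 / V`
    have key : ∀ r : ℂ[X], r.natDegree ≤ q.natDegree → Polynomial.aeval V r =
        Polynomial.aeval V⁻¹ (r.reflect q.natDegree) * V ^ q.natDegree := by
      intro r hr
      let _ : Invertible V := invertibleOfNonzero h0
      have := eval₂_reflect_mul_pow (algebraMap ℂ (RatFunc ℂ)) V q.natDegree r hr
      rw [invOf_eq_inv] at this
      exact this.symm
    have heval : ∀ r : ℂ[X], (r.reflect q.natDegree).eval 0 = r.coeff q.natDegree := by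
      intro r
      rw [← coeff_zero_eq_eval_zero, coeff_reflect, revAt_le (Nat.zero_le _), Nat.sub_zero]
    have hq' : (q.reflect q.natDegree).eval 0 ≠ 0 := by
      rw [heval, coeff_natDegree]
      exact leadingCoeff_ne_zero.mpr hq
    rw [compHom_div, key p hpq, key q le_rfl, mul_div_mul_right _ _ (pow_ne_zero _ h0),
      div_eq_mul_inv]
    have h1 := (h.aeval (p.reflect q.natDegree)).mul ((h.aeval (q.reflect q.natDegree)).inv hq')
    rw [heval, heval, coeff_natDegree] at h1
    rwa [hc, mul_assoc, mul_inv_cancel₀ (leadingCoeff_ne_zero.mpr hq), mul_one] at h1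

theorem val_comp {U V : RatFunc ℂ} (hV : 0 < deg V) (z : Sphere) :
    val (comp U V) z = val U (val V z) := by
  rw [comp_eq_compHom U V hV]
  rcases val_spec U (val V z) with ⟨c, hc, h⟩ | ⟨hc, h0, h⟩
  · rw [hc, (h.compHom hV).val_eq]
  · rw [hc]
    refine val_eq_infty ((_root_.map_ne_zero _).mpr h0) ?_
    rw [← map_inv₀]
    exact h.compHom hV

/-! ### Local degrees as orders of vanishing -/

/-- A local parameter at a point of the sphere: `X - a` at `a`, and `1 / X` at `∞`. -/
noncomputable def localParam : Sphere → RatFunc ℂ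
  | some a => RatFunc.X - RatFunc.C a
  | none => RatFunc.X⁻¹

/-- The function `f` read in the local parameter at the point `w` of the target:
`f - w` for finite `w`, and `1 / f` for `w = ∞`. -/
noncomputable def centered (f : RatFunc ℂ) : Sphere → RatFunc ℂ
  | some w => f - RatFunc.C w
  | none => f⁻¹

theorem localParam_coe (a : ℂ) : localParam (a : Sphere) = RatFunc.X - RatFunc.C a := rfl

theorem localParam_infty : localParam OnePoint.infty = RatFunc.X⁻¹ := rfl

theorem centered_coe (f : RatFunc ℂ) (w : ℂ) : centered f (w : Sphere) = f - RatFunc.C w := rfl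

theorem centered_infty (f : RatFunc ℂ) : centered f OnePoint.infty = f⁻¹ := rfl

theorem fiberPoly_coe (f : RatFunc ℂ) (w : ℂ) :
    fiberPoly f (w : Sphere) = f.num - C w * f.denom := rfl

theorem fiberPoly_infty (f : RatFunc ℂ) : fiberPoly f OnePoint.infty = f.denom := rfl

theorem localDeg_coe (f : RatFunc ℂ) (a : ℂ) : localDeg f (a : Sphere) =
    (fiberPoly f (val f (a : Sphere))).rootMultiplicity a := rfl

theorem localDeg_infty (f : RatFunc ℂ) : localDeg f OnePoint.infty =
    deg f - (fiberPoly f (val f OnePoint.infty)).natDegree := rfl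

/-- The function `f` vanishes to order exactly `e` at `z`. -/
def HasOrder (z : Sphere) (f : RatFunc ℂ) (e : ℕ) : Prop :=
  ∃ u c, c ≠ 0 ∧ HasValue z u c ∧ f = localParam z ^ e * u

theorem algebraMap_X_sub_C (a : ℂ) :
    algebraMap ℂ[X] (RatFunc ℂ) (X - C a) = RatFunc.X - RatFunc.C a := by
  simp [RatFunc.algebraMap_X]

theorem localParam_ne_zero (z : Sphere) : localParam z ≠ 0 := by
  induction z using OnePoint.rec with
  | infty => exact inv_ne_zero RatFunc.X_ne_zero
  | coe a =>
    rw [localParam_coe, ← algebraMap_X_sub_C]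
    exact RatFunc.algebraMap_ne_zero (X_sub_C_ne_zero a)

theorem hasValue_localParam (z : Sphere) : HasValue z (localParam z) 0 := by
  induction z using OnePoint.rec with
  | infty =>
    refine ⟨1, X, X_ne_zero, by simp [localParam_infty, RatFunc.algebraMap_X], by simp, ?_⟩
    simp [coeff_one]
  | coe a =>
    exact ⟨X - C a, 1, by simp, by rw [algebraMap_X_sub_C, localParam_coe]; simp, by simp⟩

theorem HasOrder.le {z : Sphere} {f : RatFunc ℂ} {e e' : ℕ} (h : HasOrder z f e)
    (h' : HasOrder z f e') : e' ≤ e := by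
  by_contra! hlt
  obtain ⟨u, c, hc, hu, rfl⟩ := h
  obtain ⟨u', c', hc', hu', h⟩ := h'
  obtain ⟨k, rfl⟩ := Nat.exists_eq_add_of_lt hlt
  rw [add_assoc, pow_add, mul_assoc] at h
  have h1 := mul_left_cancel₀ (pow_ne_zero _ (localParam_ne_zero z)) h
  have h2 := ((hasValue_localParam z).pow (k + 1)).mul hu'
  rw [← h1, zero_pow k.succ_ne_zero, zero_mul] at h2
  exact hc (hu.unique h2)

theorem HasOrder.unique {z : Sphere} {f : RatFunc ℂ} {e e' : ℕ} (h : HasOrder z f e)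
    (h' : HasOrder z f e') : e = e' :=
  le_antisymm (h'.le h) (h.le h')

theorem fiberPoly_ne_zero {f : RatFunc ℂ} (hf : 0 < deg f) (w : Sphere) : fiberPoly f w ≠ 0 := by
  induction w using OnePoint.rec with
  | infty => exact f.denom_ne_zero
  | coe w =>
    intro h
    rw [fiberPoly_coe, sub_eq_zero] at h
    refine hf.ne' ((deg_eq_zero_iff f).mpr ⟨w, ?_⟩)
    rw [← f.num_div_denom, h, map_mul,
      mul_div_cancel_right₀ _ (RatFunc.algebraMap_ne_zero f.denom_ne_zero), RatFunc.algebraMap_C]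

theorem val_coe_eq_infty_iff {f : RatFunc ℂ} {a : ℂ} :
    val f (a : Sphere) = OnePoint.infty ↔ f.denom.eval a = 0 := by
  rw [val_coe]
  split_ifs with h <;> simp [h]

theorem val_infty_eq_infty_iff {f : RatFunc ℂ} :
    val f OnePoint.infty = OnePoint.infty ↔ f.denom.natDegree < f.num.natDegree := by
  rw [val_infty]
  split_ifs with h <;> simp [h]

/-- The finite points of a fibre are the roots of its polynomial. -/
theorem fiberPoly_eval_eq_zero_iff (f : RatFunc ℂ) (w : Sphere) (a : ℂ) :
    (fiberPoly f w).eval a = 0 ↔ val f (a : Sphere) = w := by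
  induction w using OnePoint.rec with
  | infty => rw [fiberPoly_infty, val_coe_eq_infty_iff]
  | coe w =>
    rw [fiberPoly_coe, val_coe, eval_sub, eval_mul, eval_C, sub_eq_zero]
    split_ifs with h
    · simp [h, num_eval_ne_zero h, OnePoint.infty_ne_coe]
    · rw [OnePoint.coe_eq_coe, div_eq_iff h]

theorem natDegree_fiberPoly_le (f : RatFunc ℂ) (w : Sphere) :
    (fiberPoly f w).natDegree ≤ deg f := by
  induction w using OnePoint.rec with
  | infty => exact le_max_right _ _
  | coe w =>
    rw [fiberPoly_coe]
    exact (natDegree_sub_le _ _).trans (max_le_max le_rfl (natDegree_C_mul_le _ _))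

/-- The point `∞` lies in a fibre when the polynomial of the fibre drops degree. -/
theorem natDegree_fiberPoly_lt_iff {f : RatFunc ℂ} (hf : 0 < deg f) (w : Sphere) :
    (fiberPoly f w).natDegree < deg f ↔ val f OnePoint.infty = w := by
  have hd := leadingCoeff_ne_zero.mpr f.denom_ne_zero
  induction w using OnePoint.rec with
  | infty =>
    rw [fiberPoly_infty, val_infty_eq_infty_iff, deg]
    omega
  | coe w =>
    rw [fiberPoly_coe, val_infty]
    split_ifs with h
    · simp only [OnePoint.infty_ne_coe, iff_false, not_lt]
      rw [natDegree_sub_eq_left_of_natDegree_lt ((natDegree_C_mul_le _ _).trans_lt h), deg]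
      omega
    · rw [OnePoint.coe_eq_coe, div_eq_iff hd]
      have hdeg : deg f = f.denom.natDegree := by rw [deg]; omega
      have hcoeff : (f.num - C w * f.denom).coeff f.denom.natDegree =
          f.num.coeff f.denom.natDegree - w * f.denom.leadingCoeff := by simp
      rw [hdeg, ← sub_eq_zero, ← hcoeff]
      refine ⟨coeff_eq_zero_of_natDegree_lt, fun h0 => ?_⟩
      refine lt_of_le_of_ne (hdeg ▸ natDegree_fiberPoly_le f (w : Sphere)) fun heq => ?_
      rw [← heq, coeff_natDegree, leadingCoeff_eq_zero] at h0
      exact fiberPoly_ne_zero hf (w : Sphere) h0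

/-- The function `f` read in the local parameter at a point `w` is the quotient of the
polynomial of the fibre over `w` by a polynomial that does not vanish on that fibre. -/
theorem centered_eq_div (f : RatFunc ℂ) (w : Sphere) : ∃ q : ℂ[X],
    centered f w = algebraMap ℂ[X] (RatFunc ℂ) (fiberPoly f w) / algebraMap ℂ[X] (RatFunc ℂ) q ∧
    (∀ a : ℂ, val f (a : Sphere) = w → q.eval a ≠ 0) ∧
    (val f OnePoint.infty = w → q ≠ 0 ∧ q.natDegree = deg f) := by
  induction w using OnePoint.rec with
  | infty =>
    refine ⟨f.num, ?_, fun a ha => num_eval_ne_zero (val_coe_eq_infty_iff.mp ha), fun h => ?_⟩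
    · rw [centered_infty, fiberPoly_infty]
      conv_lhs => rw [← f.num_div_denom]
      rw [inv_div]
    · rw [val_infty_eq_infty_iff] at h
      refine ⟨?_, by rw [deg]; omega⟩
      intro h0
      simp [h0] at h
  | coe w =>
    refine ⟨f.denom, ?_, fun a ha h0 => ?_, fun h => ⟨f.denom_ne_zero, ?_⟩⟩
    · have hd := RatFunc.algebraMap_ne_zero f.denom_ne_zero
      rw [centered_coe, fiberPoly_coe, map_sub, map_mul, RatFunc.algebraMap_C, sub_div,
        mul_div_cancel_right₀ _ hd, f.num_div_denom]
    · rw [val_coe_eq_infty_iff.mpr h0] at ha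
      exact OnePoint.infty_ne_coe w ha
    · have : val f OnePoint.infty ≠ OnePoint.infty := by
        rw [h]
        exact OnePoint.coe_ne_infty w
      rw [ne_eq, val_infty_eq_infty_iff] at this
      rw [deg]
      omega

theorem localDeg_pos {f : RatFunc ℂ} (hf : 0 < deg f) (z : Sphere) : 0 < localDeg f z := by
  induction z using OnePoint.rec with
  | infty =>
    rw [localDeg_infty]
    exact Nat.sub_pos_of_lt ((natDegree_fiberPoly_lt_iff hf _).mpr rfl)
  | coe a =>
    rw [localDeg_coe, rootMultiplicity_pos (fiberPoly_ne_zero hf _)]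
    exact (fiberPoly_eval_eq_zero_iff f _ a).mpr rfl

/-- The local degree of `f` at `z` is the order of vanishing at `z` of `f - f(z)`, respectively
of `1 / f` at a pole. -/
theorem hasOrder_localDeg {f : RatFunc ℂ} (hf : 0 < deg f) (z : Sphere) :
    HasOrder z (centered f (val f z)) (localDeg f z) := by
  obtain ⟨q, hq, hq1, hq2⟩ := centered_eq_div f (val f z)
  have hP := fiberPoly_ne_zero hf (val f z)
  induction z using OnePoint.rec with
  | infty =>
    obtain ⟨hq0, hqd⟩ := hq2 rfl
    rw [hq, localDeg_infty]
    set P := fiberPoly f (val f OnePoint.infty)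
    have hle : P.natDegree ≤ deg f := natDegree_fiberPoly_le f _
    have hnat : (X ^ (deg f - P.natDegree) * P).natDegree = q.natDegree := by
      rw [natDegree_mul (pow_ne_zero _ X_ne_zero) hP, natDegree_X_pow, hqd]
      omega
    refine ⟨algebraMap ℂ[X] (RatFunc ℂ) (X ^ (deg f - P.natDegree) * P) / algebraMap _ _ q,
      P.leadingCoeff / q.leadingCoeff,
      div_ne_zero (leadingCoeff_ne_zero.mpr hP) (leadingCoeff_ne_zero.mpr hq0),
      ⟨_, q, hq0, rfl, hnat.le, ?_⟩, ?_⟩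
    · rw [← hnat, coeff_natDegree, leadingCoeff_mul, leadingCoeff_X_pow, one_mul,
        div_mul_cancel₀ _ (leadingCoeff_ne_zero.mpr hq0)]
    · rw [localParam_infty, map_mul, map_pow, RatFunc.algebraMap_X, inv_pow, mul_div_assoc,
        inv_mul_cancel_left₀ (pow_ne_zero _ RatFunc.X_ne_zero)]
  | coe a =>
    rw [hq, localDeg_coe]
    set P := fiberPoly f (val f (a : Sphere))
    obtain ⟨g, hg, hga⟩ := exists_eq_pow_rootMultiplicity_mul_and_not_dvd P hP a
    have hqa := hq1 a rfl
    rw [dvd_iff_isRoot, IsRoot.def] at hga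
    refine ⟨algebraMap ℂ[X] (RatFunc ℂ) g / algebraMap _ _ q, g.eval a / q.eval a,
      div_ne_zero hga hqa, ⟨g, q, hqa, rfl, (div_mul_cancel₀ _ hqa).symm⟩, ?_⟩
    rw [localParam_coe, ← algebraMap_X_sub_C, ← map_pow, ← mul_div_assoc, ← map_mul, ← hg]

theorem compHom_localParam {V : RatFunc ℂ} (hV : 0 < deg V) (w : Sphere) :
    compHom V hV (localParam w) = centered V w := by
  induction w using OnePoint.rec with
  | infty => rw [localParam_infty, centered_infty, map_inv₀, compHom_X]
  | coe a => rw [localParam_coe, centered_coe, map_sub, compHom_X, compHom_C]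

theorem compHom_centered {V : RatFunc ℂ} (hV : 0 < deg V) (U : RatFunc ℂ) (w : Sphere) :
    compHom V hV (centered U w) = centered (comp U V) w := by
  rw [comp_eq_compHom U V hV]
  induction w using OnePoint.rec with
  | infty => rw [centered_infty, centered_infty, map_inv₀]
  | coe a => rw [centered_coe, centered_coe, map_sub, compHom_C]

/-- Local degrees are multiplicative under composition. -/
theorem localDeg_comp {U V : RatFunc ℂ} (hU : 0 < deg U) (hV : 0 < deg V) (z : Sphere) :
    localDeg (comp U V) z = localDeg U (val V z) * localDeg V z := by
  refine (hasOrder_localDeg (deg_comp_pos hU hV) z).unique ?_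
  obtain ⟨u, c, hc, hu, hU'⟩ := hasOrder_localDeg hU (val V z)
  obtain ⟨v, d, hd, hv, hV'⟩ := hasOrder_localDeg hV z
  refine ⟨v ^ localDeg U (val V z) * compHom V hV u, d ^ localDeg U (val V z) * c,
    mul_ne_zero (pow_ne_zero _ hd) hc, (hv.pow _).mul (hu.compHom hV), ?_⟩
  rw [val_comp hV, ← compHom_centered hV, hU', map_mul, map_pow, compHom_localParam, hV']
  ring

/-! ### Counting the points of a fibre -/

open Classical in
/-- The fibre of a nonconstant rational function over a point of the sphere. -/
noncomputable def fiber (f : RatFunc ℂ) (w : Sphere) : Finset Sphere :=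
  (fiberPoly f w).roots.toFinset.image (fun a : ℂ => (a : Sphere)) ∪
    if val f OnePoint.infty = w then {OnePoint.infty} else ∅

theorem mem_fiber {f : RatFunc ℂ} (hf : 0 < deg f) {w z : Sphere} :
    z ∈ fiber f w ↔ val f z = w := by
  classical
  have hP := fiberPoly_ne_zero hf w
  induction z using OnePoint.rec with
  | infty =>
    rw [fiber]
    split_ifs with h <;> simp [h]
  | coe a =>
    rw [← fiberPoly_eval_eq_zero_iff]
    rw [fiber]
    split_ifs with h <;> simp [hP]

/-- The points of a fibre, counted with their local degrees, number `deg f`. -/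
theorem sum_localDeg_fiber {f : RatFunc ℂ} (hf : 0 < deg f) (w : Sphere) :
    ∑ z ∈ fiber f w, localDeg f z = deg f := by
  classical
  have hP := fiberPoly_ne_zero hf w
  have hfin : ∑ z ∈ (fiberPoly f w).roots.toFinset.image (fun a : ℂ => (a : Sphere)),
      localDeg f z = (fiberPoly f w).natDegree := by
    rw [Finset.sum_image (fun a _ b _ h => OnePoint.coe_injective h),
      (IsAlgClosed.splits (fiberPoly f w)).natDegree_eq_card_roots,
      ← Multiset.toFinset_sum_count_eq]
    refine Finset.sum_congr rfl fun a ha => ?_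
    rw [Multiset.mem_toFinset, mem_roots hP, IsRoot.def, fiberPoly_eval_eq_zero_iff] at ha
    rw [localDeg_coe, ha, count_roots]
  rw [fiber, Finset.sum_union, hfin]
  · split_ifs with h
    · rw [Finset.sum_singleton, localDeg_infty, h]
      exact Nat.add_sub_cancel' (natDegree_fiberPoly_le f w)
    · rw [Finset.sum_empty, add_zero]
      rw [← natDegree_fiberPoly_lt_iff hf] at h
      exact le_antisymm (natDegree_fiberPoly_le f w) (not_lt.mp h)
  · split_ifs with h <;> simp

/-! ### The Riemann–Hurwitz inequality -/

theorem wronskian_num_denom_ne_zero {f : RatFunc ℂ} (hf : 0 < deg f) :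
    wronskian f.num f.denom ≠ 0 := by
  rw [ne_eq, f.isCoprime_num_denom.wronskian_eq_zero_iff]
  rintro ⟨h1, h2⟩
  have h1 := derivative_eq_zero.mp h1
  have h2 := derivative_eq_zero.mp h2
  rw [deg] at hf
  omega

theorem wronskian_fiberPoly (f : RatFunc ℂ) (w : ℂ) :
    wronskian (fiberPoly f (w : Sphere)) f.denom = wronskian f.num f.denom := by
  simp only [fiberPoly_coe, wronskian, derivative_sub, derivative_C_mul]
  ring

theorem pow_sub_one_dvd_wronskian {P Q D : ℂ[X]} {n : ℕ} (h : D ^ n ∣ P) :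
    D ^ (n - 1) ∣ wronskian P Q :=
  dvd_sub (((pow_dvd_pow _ n.pred_le).trans h).mul_right _)
    ((pow_sub_one_dvd_derivative_of_pow_dvd h).mul_right _)

/-- A finite point of local degree `e` is a zero of order at least `e - 1` of the Wronskian. -/
theorem localDeg_coe_sub_one_le {f : RatFunc ℂ} (hf : 0 < deg f) (a : ℂ) :
    localDeg f (a : Sphere) - 1 ≤ (wronskian f.num f.denom).rootMultiplicity a := by
  rw [le_rootMultiplicity_iff (wronskian_num_denom_ne_zero hf), localDeg_coe]
  have h := pow_rootMultiplicity_dvd (fiberPoly f (val f (a : Sphere))) a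
  generalize hw : val f (a : Sphere) = w at h ⊢
  induction w using OnePoint.rec with
  | infty =>
    rw [← wronskian_neg_eq, dvd_neg]
    exact pow_sub_one_dvd_wronskian h
  | coe w =>
    rw [← wronskian_fiberPoly f w]
    exact pow_sub_one_dvd_wronskian h

/-- The Wronskian has degree at most `2 deg f - 2`, and less if `f` is ramified at `∞`. -/
theorem natDegree_wronskian_add_localDeg_infty_lt {f : RatFunc ℂ} (hf : 0 < deg f) :
    (wronskian f.num f.denom).natDegree + localDeg f OnePoint.infty < 2 * deg f := by
  have hW := wronskian_num_denom_ne_zero hf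
  have hle := natDegree_fiberPoly_le f (val f OnePoint.infty)
  rw [localDeg_infty]
  generalize hw : val f OnePoint.infty = w at hle ⊢
  induction w using OnePoint.rec with
  | infty =>
    have h := natDegree_wronskian_lt_add hW
    rw [val_infty_eq_infty_iff] at hw
    rw [fiberPoly_infty] at hle ⊢
    have : f.num.natDegree ≤ deg f := le_max_left _ _
    omega
  | coe w =>
    rw [← wronskian_fiberPoly f w] at hW ⊢
    have h := natDegree_wronskian_lt_add hW
    have : f.denom.natDegree ≤ deg f := le_max_right _ _
    omega

/-- The ramification of a rational function of degree `d` over the sphere is at most `2 d - 2`. -/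
theorem sum_localDeg_sub_one_le {f : RatFunc ℂ} (hf : 0 < deg f) (T : Finset Sphere) :
    ∑ z ∈ T, (localDeg f z - 1) + 2 ≤ 2 * deg f := by
  classical
  have hW := natDegree_wronskian_add_localDeg_infty_lt hf
  have hinf := localDeg_pos hf OnePoint.infty
  set W := wronskian f.num f.denom with hWdef
  have hfin : ∑ z ∈ T.erase OnePoint.infty, (localDeg f z - 1) ≤ W.natDegree := by
    have hT : T.erase OnePoint.infty = (T.preimage (fun a : ℂ => (a : Sphere))
        OnePoint.coe_injective.injOn).image (fun a : ℂ => (a : Sphere)) := by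
      ext z
      induction z using OnePoint.rec with
      | infty => simp
      | coe a => simp
    rw [hT, Finset.sum_image (fun a _ b _ h => OnePoint.coe_injective h)]
    refine (Finset.sum_le_sum fun a _ => localDeg_coe_sub_one_le hf a).trans ?_
    rw [← hWdef]
    simp only [← count_roots]
    refine le_trans ?_ (card_roots' W)
    rw [← Multiset.toFinset_sum_count_eq]
    refine Finset.sum_le_sum_of_ne_zero fun a _ ha => ?_
    rwa [Multiset.mem_toFinset, ← Multiset.count_ne_zero]
  have := Finset.sum_le_sum_of_subset (f := fun z => localDeg f z - 1)
    (Finset.insert_erase_subset OnePoint.infty T)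
  rw [Finset.sum_insert (Finset.notMem_erase _ _)] at this
  omega

end RatMap

namespace SphereOrbifold

open RatMap

/-! ### Minimal holomorphic maps -/

theorem ν_ne_zero (O : SphereOrbifold) (z : Sphere) : O.ν z ≠ 0 :=
  (Nat.lt_of_lt_of_le Nat.zero_lt_one (O.one_le z)).ne'

/-- The identity behind compositions of minimal maps: with `a` the value of `ν` at an intermediate
point, `N` its value at the image, and local degrees `d` and `e` of the two maps. -/
theorem gcd_mul_of_eq_mul_gcd {N a e : ℕ} (hN : 0 < N) (h : N = a * Nat.gcd e N) (d : ℕ) :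
    Nat.gcd (e * d) N = Nat.gcd e N * Nat.gcd d a := by
  have hg : 0 < Nat.gcd e N := Nat.gcd_pos_of_pos_right _ hN
  obtain ⟨g, e', n', hg', hcop, he, hn⟩ := Nat.exists_coprime' (m := e) (n := N) hg
  have hgcd : Nat.gcd e N = g := by
    rw [he, hn, Nat.gcd_mul_right, hcop.gcd_eq_one, one_mul]
  have ha : a = n' := by
    rw [hgcd, hn] at h
    exact (Nat.eq_of_mul_eq_mul_right hg' h).symm
  rw [hgcd, ha]
  conv_lhs => rw [he, hn]
  rw [mul_right_comm, mul_comm (e' * d), mul_comm n', Nat.gcd_mul_left,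
    hcop.gcd_mul_left_cancel]

theorem IsMinimal.comp {O₁ O₂ O₃ : SphereOrbifold} {U V : RatFunc ℂ} (hU : IsMinimal U O₂ O₃)
    (hV : IsMinimal V O₁ O₂) : IsMinimal (RatMap.comp U V) O₁ O₃ := by
  refine ⟨deg_comp_pos hU.1 hV.1, fun z => ?_⟩
  rw [val_comp hV.1, localDeg_comp hU.1 hV.1,
    gcd_mul_of_eq_mul_gcd (O₃.one_le _) (hU.2 (val V z))]
  conv_lhs => rw [hU.2 (val V z), hV.2 z]
  ring

theorem isMinimal_pullback {U : RatFunc ℂ} (hU : 0 < deg U) (O : SphereOrbifold) :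
    IsMinimal U (O.pullback U) O :=
  ⟨hU, fun _ => (Nat.div_mul_cancel (Nat.gcd_dvd_right _ _)).symm⟩

/-- If a composition `U ∘ V` is minimal, then `V` is minimal onto the pullback by `U`. -/
theorem IsMinimal.of_comp {O₁ O₂ : SphereOrbifold} {U V : RatFunc ℂ} (hU : 0 < deg U)
    (hV : 0 < deg V) (h : IsMinimal (RatMap.comp U V) O₁ O₂) :
    IsMinimal V O₁ (O₂.pullback U) := by
  refine ⟨hV, fun z => ?_⟩
  have h1 := h.2 z
  have h2 := (isMinimal_pullback hU O₂).2 (val V z)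
  rw [val_comp hV, localDeg_comp hU hV,
    gcd_mul_of_eq_mul_gcd (O₂.one_le _) h2] at h1
  conv_lhs at h1 => rw [h2]
  refine Nat.eq_of_mul_eq_mul_right
    (Nat.gcd_pos_of_pos_right (localDeg U (val V z)) (O₂.one_le (val U (val V z)))) ?_
  rw [h1]
  ring

theorem IsMinimal.dvd {O₁ O₂ : SphereOrbifold} {f : RatFunc ℂ} (h : IsMinimal f O₁ O₂)
    (z : Sphere) : O₁.ν z ∣ O₂.ν (val f z) :=
  ⟨_, h.2 z⟩

theorem mem_signature {O : SphereOrbifold} {n : ℕ} :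
    n ∈ O.signature ↔ ∃ z, 1 < O.ν z ∧ O.ν z = n := by
  simp [signature]

theorem two_le_of_mem_signature {O : SphereOrbifold} {n : ℕ} (h : n ∈ O.signature) : 2 ≤ n := by
  obtain ⟨z, hz, rfl⟩ := mem_signature.mp h
  exact hz

theorem IsMinimal.exists_dvd {O₁ O₂ : SphereOrbifold} {f : RatFunc ℂ} (h : IsMinimal f O₁ O₂) :
    ∀ n ∈ O₁.signature, ∃ m ∈ O₂.signature, n ∣ m := by
  intro n hn
  obtain ⟨z, hz, rfl⟩ := mem_signature.mp hn
  exact ⟨_, mem_signature.mpr ⟨_, hz.trans_le (Nat.le_of_dvd (O₂.one_le _) (h.dvd z)), rfl⟩,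
    h.dvd z⟩

/-! ### Euler characteristics -/

/-- The Euler characteristic of an orbifold on the sphere with a given signature. -/
def eulerChar (s : Multiset ℕ) : ℚ := 2 - (s.map fun n : ℕ => 1 - 1 / (n : ℚ)).sum

theorem eulerChar_signature (O : SphereOrbifold) :
    eulerChar O.signature = 2 - ∑ z ∈ O.finite.toFinset, (1 - 1 / (O.ν z : ℚ)) := by
  rw [eulerChar, signature, Multiset.map_map]
  rfl

/-- The Riemann–Hurwitz inequality for a minimal holomorphic map. -/
theorem IsMinimal.eulerChar_le {O₁ O₂ : SphereOrbifold} {f : RatFunc ℂ}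
    (h : IsMinimal f O₁ O₂) : eulerChar O₁.signature ≤ deg f * eulerChar O₂.signature := by
  classical
  have hdisj : ((O₂.finite.toFinset : Finset Sphere) : Set Sphere).PairwiseDisjoint (fiber f) := by
    intro w _ w' _ hne
    refine Finset.disjoint_left.mpr fun z hz hz' => hne ?_
    rw [← (mem_fiber h.1).mp hz, (mem_fiber h.1).mp hz']
  have hsub : O₁.finite.toFinset ⊆ O₂.finite.toFinset.biUnion (fiber f) := by
    intro z hz
    rw [Set.Finite.mem_toFinset] at hz
    rw [Finset.mem_biUnion]
    refine ⟨val f z, ?_, (mem_fiber h.1).mpr rfl⟩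
    rw [Set.Finite.mem_toFinset]
    exact lt_of_lt_of_le hz (Nat.le_of_dvd (O₂.one_le _) (h.dvd z))
  have hext : ∑ z ∈ O₁.finite.toFinset, (1 - 1 / (O₁.ν z : ℚ)) =
      ∑ z ∈ O₂.finite.toFinset.biUnion (fiber f), (1 - 1 / (O₁.ν z : ℚ)) := by
    refine Finset.sum_subset hsub fun z _ hz => ?_
    rw [Set.Finite.mem_toFinset, Set.mem_ofPred_eq, not_lt] at hz
    rw [le_antisymm hz (O₁.one_le z)]
    norm_num
  -- for `z` over `w` of local degree `e`, minimality gives `ν₂ w ≤ e * ν₁ z`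
  have hterm : ∀ z, (localDeg f z : ℚ) * (1 - 1 / (O₂.ν (val f z) : ℚ)) -
      ((localDeg f z - 1 : ℕ) : ℚ) ≤ 1 - 1 / (O₁.ν z : ℚ) := by
    intro z
    have he := localDeg_pos h.1 z
    have h1 : (0 : ℚ) < O₁.ν z := by exact_mod_cast O₁.one_le z
    have h2 : (0 : ℚ) < O₂.ν (val f z) := by exact_mod_cast O₂.one_le _
    have hle : O₂.ν (val f z) ≤ O₁.ν z * localDeg f z := by
      conv_lhs => rw [h.2 z]
      exact Nat.mul_le_mul_left _ (Nat.gcd_le_left _ he)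
    have hle' : (O₂.ν (val f z) : ℚ) ≤ O₁.ν z * localDeg f z := by exact_mod_cast hle
    have : 1 / (O₁.ν z : ℚ) ≤ localDeg f z / O₂.ν (val f z) := by
      rw [div_le_div_iff₀ h1 h2]
      linarith
    rw [Nat.cast_sub he, mul_sub, mul_one_div]
    push_cast
    linarith
  have hsum : ∑ z ∈ O₂.finite.toFinset.biUnion (fiber f),
      (localDeg f z : ℚ) * (1 - 1 / (O₂.ν (val f z) : ℚ)) =
      deg f * ∑ w ∈ O₂.finite.toFinset, (1 - 1 / (O₂.ν w : ℚ)) := by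
    rw [Finset.sum_biUnion hdisj, Finset.mul_sum]
    refine Finset.sum_congr rfl fun w _ => ?_
    rw [← sum_localDeg_fiber h.1 w, Nat.cast_sum, Finset.sum_mul]
    refine Finset.sum_congr rfl fun z hz => ?_
    rw [(mem_fiber h.1).mp hz]
  have hRH : ((∑ z ∈ O₂.finite.toFinset.biUnion (fiber f), (localDeg f z - 1) + 2 : ℕ) : ℚ) ≤
      ((2 * deg f : ℕ) : ℚ) := Nat.cast_le.mpr (sum_localDeg_sub_one_le h.1 _)
  have hle := Finset.sum_le_sum (s := O₂.finite.toFinset.biUnion (fiber f)) fun z _ => hterm z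
  rw [Finset.sum_sub_distrib, hsum] at hle
  rw [eulerChar_signature, eulerChar_signature, hext]
  push_cast at hRH
  linarith

/-! ### Congruences modulo a prime -/

/-- The number of entries of a signature whose `p`-adic valuation is `a`. -/
def countVal (s : Multiset ℕ) (p a : ℕ) : ℕ := s.countP fun n => n.factorization p = a

open Classical in
/-- The singular points of an orbifold at which `ν` has `p`-adic valuation `a`. -/
noncomputable def levelSet (O : SphereOrbifold) (p a : ℕ) : Finset Sphere :=
  O.finite.toFinset.filter fun z => (O.ν z).factorization p = a

theorem card_levelSet (O : SphereOrbifold) (p a : ℕ) :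
    (O.levelSet p a).card = countVal O.signature p a := by
  rw [countVal, signature, Multiset.countP_map, levelSet, Finset.card_def, Finset.filter_val]

theorem mem_levelSet {O : SphereOrbifold} {p a : ℕ} (ha : 1 ≤ a) {z : Sphere} :
    z ∈ O.levelSet p a ↔ (O.ν z).factorization p = a := by
  rw [levelSet, Finset.mem_filter, Set.Finite.mem_toFinset, Set.mem_ofPred_eq,
    and_iff_right_of_imp]
  intro h
  refine lt_of_le_of_ne (O.one_le z) fun h1 => ?_
  rw [← h1] at h
  simp at h
  omega

theorem IsMinimal.factorization_le {O₁ O₂ : SphereOrbifold} {f : RatFunc ℂ}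
    (h : IsMinimal f O₁ O₂) (p : ℕ) (z : Sphere) :
    (O₁.ν z).factorization p ≤ (O₂.ν (val f z)).factorization p :=
  (Nat.factorization_le_iff_dvd (O₁.ν_ne_zero z) (O₂.ν_ne_zero _)).mpr (h.dvd z) p

/-- Over a point at which `p` divides `ν₂`, the local degree is prime to `p` exactly where `ν₁`
and `ν₂` have the same `p`-adic valuation. -/
theorem IsMinimal.not_dvd_localDeg_iff {O₁ O₂ : SphereOrbifold} {f : RatFunc ℂ}
    (h : IsMinimal f O₁ O₂) {p : ℕ} (hp : p.Prime) {z : Sphere}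
    (hz : 1 ≤ (O₂.ν (val f z)).factorization p) :
    ¬ p ∣ localDeg f z ↔ (O₁.ν z).factorization p = (O₂.ν (val f z)).factorization p := by
  have h2 : O₂.ν (val f z) ≠ 0 := (O₂.ν_ne_zero _)
  have hg : Nat.gcd (localDeg f z) (O₂.ν (val f z)) ≠ 0 := Nat.gcd_ne_zero_right h2
  have hdvd : p ∣ O₂.ν (val f z) := Nat.dvd_of_factorization_pos (by omega)
  have hfac := congrArg (fun n => n.factorization p) (h.2 z)
  beta_reduce at hfac
  rw [Nat.factorization_mul (O₁.ν_ne_zero z) hg, Finsupp.add_apply] at hfac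
  have key : p ∣ localDeg f z ↔
      (Nat.gcd (localDeg f z) (O₂.ν (val f z))).factorization p ≠ 0 := by
    rw [← Nat.one_le_iff_ne_zero, ← hp.dvd_iff_one_le_factorization hg, Nat.dvd_gcd_iff,
      and_iff_left hdvd]
  rw [key]
  omega

open Classical in
/-- Modulo `p`, only the points where `ν₁` keeps the `p`-adic valuation of `ν₂ w` contribute to
the degree of the fibre over `w`. -/
theorem IsMinimal.deg_modEq {O₁ O₂ : SphereOrbifold} {f : RatFunc ℂ}
    (h : IsMinimal f O₁ O₂) {p a : ℕ} (hp : p.Prime) (ha : 1 ≤ a) {w : Sphere}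
    (hw : (O₂.ν w).factorization p = a) :
    deg f ≡ ∑ z ∈ (O₁.levelSet p a).filter (fun z => val f z = w), localDeg f z [MOD p] := by
  have hset : (O₁.levelSet p a).filter (fun z => val f z = w) =
      (fiber f w).filter (fun z => (O₁.ν z).factorization p = a) := by
    ext z
    rw [Finset.mem_filter, Finset.mem_filter, mem_levelSet ha, mem_fiber h.1, and_comm]
  rw [hset, ← sum_localDeg_fiber h.1 w,
    ← Finset.sum_filter_add_sum_filter_not (fiber f w) (fun z => (O₁.ν z).factorization p = a)]
  conv_rhs => rw [← add_zero (Finset.sum _ _)]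
  refine Nat.ModEq.add_left _ ((Nat.modEq_zero_iff_dvd).mpr (Finset.dvd_sum fun z hz => ?_))
  rw [Finset.mem_filter, mem_fiber h.1] at hz
  by_contra hnd
  rw [h.not_dvd_localDeg_iff hp (by rw [hz.1, hw]; exact ha), hz.1, hw] at hnd
  exact hz.2 hnd

theorem factorization_le_of_signature {O : SphereOrbifold} {p a : ℕ}
    (h : ∀ n ∈ O.signature, n.factorization p ≤ a) (z : Sphere) :
    (O.ν z).factorization p ≤ a := by
  rcases (O.one_le z).lt_or_eq with hz | hz
  · exact h _ (mem_signature.mpr ⟨z, hz, rfl⟩)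
  · rw [← hz]
    simp

theorem IsMinimal.val_mem_levelSet {O₁ O₂ : SphereOrbifold} {f : RatFunc ℂ}
    (h : IsMinimal f O₁ O₂) {p a : ℕ} (ha : 1 ≤ a)
    (htop : ∀ n ∈ O₂.signature, n.factorization p ≤ a) {z : Sphere} (hz : z ∈ O₁.levelSet p a) :
    val f z ∈ O₂.levelSet p a := by
  rw [mem_levelSet ha] at hz ⊢
  exact le_antisymm (factorization_le_of_signature htop _) (hz ▸ h.factorization_le p z)

/-- If the largest `p`-adic valuation occurring in the target is attained at exactly one point of
the source, then the degree is prime to `p`, and no positive `p`-adic valuation occurs in the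
target more often than in the source. -/
theorem IsMinimal.countVal_le {O₁ O₂ : SphereOrbifold} {f : RatFunc ℂ}
    (h : IsMinimal f O₁ O₂) {p a : ℕ} (hp : p.Prime) (ha : 1 ≤ a)
    (htop : ∀ n ∈ O₂.signature, n.factorization p ≤ a) (hone : countVal O₁.signature p a = 1)
    {b : ℕ} (hb : 1 ≤ b) : countVal O₂.signature p b ≤ countVal O₁.signature p b := by
  classical
  rw [← card_levelSet, Finset.card_eq_one] at hone
  obtain ⟨z, hz⟩ := hone
  have hzmem : z ∈ O₁.levelSet p a := by rw [hz]; exact Finset.mem_singleton_self z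
  have hwmem := h.val_mem_levelSet ha htop hzmem
  rw [mem_levelSet ha] at hwmem
  have hdeg : ¬ p ∣ deg f := by
    have hmod := h.deg_modEq hp ha hwmem
    rw [hz, Finset.filter_singleton, if_pos rfl, Finset.sum_singleton] at hmod
    rw [hmod.dvd_iff dvd_rfl, h.not_dvd_localDeg_iff hp (by rw [hwmem]; exact ha), hwmem]
    exact (mem_levelSet ha).mp hzmem
  rw [← card_levelSet, ← card_levelSet]
  refine Finset.card_le_card_of_surjOn (val f) fun w hw => ?_
  rw [Finset.mem_coe, mem_levelSet hb] at hw
  have hne : ((O₁.levelSet p b).filter (fun z => val f z = w)).Nonempty := by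
    rw [Finset.nonempty_iff_ne_empty]
    intro hempty
    have hmod := h.deg_modEq hp hb hw
    rw [hempty, Finset.sum_empty, Nat.modEq_zero_iff_dvd] at hmod
    exact hdeg hmod
  obtain ⟨y, hy⟩ := hne
  rw [Finset.mem_filter] at hy
  exact ⟨y, hy.1, hy.2⟩

/-- The number of points of the source with the largest `2`-adic valuation occurring in the target
has the parity of the degree times the number of such points in the target. -/
theorem IsMinimal.countVal_two_modEq {O₁ O₂ : SphereOrbifold} {f : RatFunc ℂ}
    (h : IsMinimal f O₁ O₂) {a : ℕ} (ha : 1 ≤ a)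
    (htop : ∀ n ∈ O₂.signature, n.factorization 2 ≤ a) :
    countVal O₁.signature 2 a ≡ countVal O₂.signature 2 a * deg f [MOD 2] := by
  classical
  rw [← card_levelSet, ← card_levelSet,
    Finset.card_eq_sum_card_fiberwise fun z hz => h.val_mem_levelSet ha htop hz,
    ← smul_eq_mul, ← Finset.sum_const]
  refine Nat.ModEq.sum fun w hw => ?_
  rw [mem_levelSet ha] at hw
  refine Nat.ModEq.trans ?_ (h.deg_modEq Nat.prime_two ha hw).symm
  rw [Finset.card_eq_sum_ones]
  refine Nat.ModEq.sum fun z hz => ?_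
  rw [Finset.mem_filter, mem_levelSet ha] at hz
  have hodd : ¬ 2 ∣ localDeg f z := by
    rw [h.not_dvd_localDeg_iff Nat.prime_two (by rw [hz.2, hw]; exact ha), hz.2, hw]
    exact hz.1
  rw [Nat.ModEq]
  omega

/-! ### Signatures of nonnegative Euler characteristic -/

theorem eulerChar_cons (n : ℕ) (s : Multiset ℕ) :
    eulerChar (n ::ₘ s) = eulerChar s - (1 - 1 / (n : ℚ)) := by
  rw [eulerChar, eulerChar, Multiset.map_cons, Multiset.sum_cons]
  ring

theorem eulerChar_zero : eulerChar 0 = 2 := by simp [eulerChar]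

theorem eulerChar_le {s : Multiset ℕ} (hs : ∀ n ∈ s, 2 ≤ n) :
    eulerChar s ≤ 2 - s.card / 2 := by
  induction s using Multiset.induction_on with
  | empty => simp [eulerChar_zero]
  | cons n s ih =>
    have hn : (2 : ℚ) ≤ n := by exact_mod_cast hs n (Multiset.mem_cons_self n s)
    have h1 : 1 / (n : ℚ) ≤ 1 / 2 := one_div_le_one_div_of_le (by norm_num) hn
    have h2 := ih fun m hm => hs m (Multiset.mem_cons_of_mem hm)
    rw [eulerChar_cons, Multiset.card_cons]
    push_cast
    linarith

theorem card_le_four {s : Multiset ℕ} (hs : ∀ n ∈ s, 2 ≤ n) (h : 0 ≤ eulerChar s) :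
    s.card ≤ 4 := by
  have h1 := eulerChar_le hs
  have h2 : (s.card : ℚ) ≤ 4 := by linarith
  exact_mod_cast h2

/-- A signature of nonnegative Euler characteristic with at least four entries is
`{2, 2, 2, 2}`. -/
theorem eq_two_two_two_two {s : Multiset ℕ} (hs : ∀ n ∈ s, 2 ≤ n) (h : 0 ≤ eulerChar s)
    (hcard : 4 ≤ s.card) : s = {2, 2, 2, 2} := by
  have hcard' : s.card = 4 := le_antisymm (card_le_four hs h) hcard
  have hall : ∀ n ∈ s, n = 2 := by
    intro n hn
    obtain ⟨t, rfl⟩ := Multiset.exists_cons_of_mem hn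
    have h1 := eulerChar_le fun m hm => hs m (Multiset.mem_cons_of_mem hm)
    rw [Multiset.card_cons] at hcard'
    have h2 : (t.card : ℚ) = 3 := by exact_mod_cast (by omega : t.card = 3)
    have h3 := hs n hn
    rw [eulerChar_cons] at h
    by_contra hne
    have hn3 : (3 : ℚ) ≤ n := by exact_mod_cast (by omega : 3 ≤ n)
    have h4 : 1 / (n : ℚ) ≤ 1 / 3 := one_div_le_one_div_of_le (by norm_num) hn3
    linarith
  rw [Multiset.eq_replicate.mpr ⟨hcard', hall⟩]
  rfl

/-- Three sorted integers, at least two, whose reciprocals sum to at least one. -/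
theorem triple_classification {a b c : ℕ} (ha : 2 ≤ a) (hab : a ≤ b) (hbc : b ≤ c)
    (h : (1 : ℚ) ≤ 1 / a + 1 / b + 1 / c) :
    (1 : ℚ) < 1 / a + 1 / b + 1 / c ∧ (a = 2 ∧ b = 2 ∨
      a = 2 ∧ b = 3 ∧ c = 3 ∨ a = 2 ∧ b = 3 ∧ c = 4 ∨ a = 2 ∧ b = 3 ∧ c = 5) ∨
    (1 : ℚ) = 1 / a + 1 / b + 1 / c ∧
      (a = 3 ∧ b = 3 ∧ c = 3 ∨ a = 2 ∧ b = 4 ∧ c = 4 ∨ a = 2 ∧ b = 3 ∧ c = 6) := by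
  have ha' : (0 : ℚ) < a := by exact_mod_cast (by omega : 0 < a)
  have hb' : (0 : ℚ) < b := by exact_mod_cast (by omega : 0 < b)
  have hc' : (0 : ℚ) < c := by exact_mod_cast (by omega : 0 < c)
  have hcb : 1 / (c : ℚ) ≤ 1 / b := one_div_le_one_div_of_le hb' (by exact_mod_cast hbc)
  have hba : 1 / (b : ℚ) ≤ 1 / a := one_div_le_one_div_of_le ha' (by exact_mod_cast hab)
  have ha3 : a ≤ 3 := by
    have : 1 / 3 ≤ 1 / (a : ℚ) := by linarith
    exact_mod_cast le_of_one_div_le_one_div (by norm_num) this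
  rcases (by omega : a = 2 ∨ a = 3) with rfl | rfl
  · have hb4 : b ≤ 4 := by
      have : 1 / 4 ≤ 1 / (b : ℚ) := by
        push_cast at h
        linarith
      exact_mod_cast le_of_one_div_le_one_div (by norm_num) this
    rcases (by omega : b = 2 ∨ b = 3 ∨ b = 4) with rfl | rfl | rfl
    · left
      refine ⟨?_, Or.inl ⟨rfl, rfl⟩⟩
      have : 0 < 1 / (c : ℚ) := by positivity
      push_cast
      linarith
    · have hc6 : c ≤ 6 := by
        have : 1 / 6 ≤ 1 / (c : ℚ) := by
          push_cast at h
          linarith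
        exact_mod_cast le_of_one_div_le_one_div (by norm_num) this
      interval_cases c <;> norm_num
    · have hc6 : c ≤ 4 := by
        have : 1 / 4 ≤ 1 / (c : ℚ) := by
          push_cast at h
          linarith
        exact_mod_cast le_of_one_div_le_one_div (by norm_num) this
      interval_cases c
      norm_num
  · have hc6 : c ≤ 3 := by
      have : 1 / 3 ≤ 1 / (c : ℚ) := by
        push_cast at h hcb hba
        linarith
      exact_mod_cast le_of_one_div_le_one_div (by norm_num) this
    obtain rfl : c = 3 := by omega
    obtain rfl : b = 3 := by omega
    norm_num

theorem exists_sorted_triple {s : Multiset ℕ} (h : s.card = 3) :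
    ∃ a b c, a ≤ b ∧ b ≤ c ∧ s = {a, b, c} := by
  have hlen := s.length_sort (· ≤ ·)
  have hsort := s.pairwise_sort (· ≤ ·)
  have heq := s.sort_eq (· ≤ ·)
  rw [h] at hlen
  obtain ⟨a, b, c, hl⟩ := List.length_eq_three.mp hlen
  rw [hl] at hsort heq
  simp only [List.pairwise_cons, List.mem_cons, forall_eq_or_imp] at hsort
  exact ⟨a, b, c, hsort.1.1, hsort.2.1.1, heq.symm⟩

/-- The signatures of nonnegative Euler characteristic, including those of bad orbifolds. -/
theorem signature_classification {s : Multiset ℕ} (hs : ∀ n ∈ s, 2 ≤ n) (h : 0 ≤ eulerChar s) :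
    0 < eulerChar s ∧ (s = 0 ∨ (∃ n, s = {n}) ∨ (∃ m n, s = {m, n}) ∨ (∃ n, s = {2, 2, n}) ∨
      s = {2, 3, 3} ∨ s = {2, 3, 4} ∨ s = {2, 3, 5}) ∨
    eulerChar s = 0 ∧ (s = {2, 2, 2, 2} ∨ s = {3, 3, 3} ∨ s = {2, 4, 4} ∨ s = {2, 3, 6}) := by
  have hcard := card_le_four hs h
  have hpos : ∀ n ∈ s, (0 : ℚ) < 1 / n := fun n hn => by
    have : (0 : ℚ) < n := by exact_mod_cast (by have := hs n hn; omega : 0 < n)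
    positivity
  rcases (by omega : s.card = 0 ∨ s.card = 1 ∨ s.card = 2 ∨ s.card = 3 ∨ 4 ≤ s.card) with
    h0 | h1 | h2 | h3 | h4
  · rw [Multiset.card_eq_zero] at h0
    subst h0
    exact Or.inl ⟨by rw [eulerChar_zero]; norm_num, Or.inl rfl⟩
  · obtain ⟨n, rfl⟩ := Multiset.card_eq_one.mp h1
    refine Or.inl ⟨?_, Or.inr (Or.inl ⟨n, rfl⟩)⟩
    have := hpos n (by simp)
    simp only [eulerChar, Multiset.map_singleton, Multiset.sum_singleton]
    linarith
  · obtain ⟨m, n, rfl⟩ := Multiset.card_eq_two.mp h2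
    refine Or.inl ⟨?_, Or.inr (Or.inr (Or.inl ⟨m, n, rfl⟩))⟩
    have := hpos m (by simp)
    have := hpos n (by simp)
    simp only [eulerChar, Multiset.insert_eq_cons, Multiset.map_cons, Multiset.sum_cons,
      Multiset.map_singleton, Multiset.sum_singleton]
    linarith
  · obtain ⟨a, b, c, hab, hbc, rfl⟩ := exists_sorted_triple h3
    have hχ : eulerChar {a, b, c} = 1 / (a : ℚ) + 1 / b + 1 / c - 1 := by
      simp only [eulerChar, Multiset.insert_eq_cons, Multiset.map_cons, Multiset.sum_cons,
        Multiset.map_singleton, Multiset.sum_singleton]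
      ring
    rw [hχ, sub_nonneg] at h
    rw [hχ, sub_pos, sub_eq_zero, eq_comm (b := (1 : ℚ))]
    rcases triple_classification (hs a (by simp)) hab hbc h with ⟨h', h''⟩ | ⟨h', h''⟩
    · refine Or.inl ⟨h', Or.inr (Or.inr (Or.inr ?_))⟩
      rcases h'' with ⟨rfl, rfl⟩ | ⟨rfl, rfl, rfl⟩ | ⟨rfl, rfl, rfl⟩ | ⟨rfl, rfl, rfl⟩
      exacts [Or.inl ⟨c, rfl⟩, Or.inr (Or.inl rfl), Or.inr (Or.inr (Or.inl rfl)),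
        Or.inr (Or.inr (Or.inr rfl))]
    · refine Or.inr ⟨h', Or.inr ?_⟩
      rcases h'' with ⟨rfl, rfl, rfl⟩ | ⟨rfl, rfl, rfl⟩ | ⟨rfl, rfl, rfl⟩
      exacts [Or.inl rfl, Or.inr (Or.inl rfl), Or.inr (Or.inr rfl)]
  · have h2222 := eq_two_two_two_two hs h h4
    refine Or.inr ⟨?_, Or.inl h2222⟩
    rw [h2222]
    simp only [eulerChar, Multiset.insert_eq_cons, Multiset.map_cons, Multiset.sum_cons,
      Multiset.map_singleton, Multiset.sum_singleton]
    norm_num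

/-! ### Rigidity of signatures -/

theorem countVal_cons (n : ℕ) (s : Multiset ℕ) (p a : ℕ) :
    countVal (n ::ₘ s) p a = countVal s p a + if n.factorization p = a then 1 else 0 := by
  rw [countVal, Multiset.countP_cons, countVal]

theorem countVal_singleton (n p a : ℕ) :
    countVal {n} p a = if n.factorization p = a then 1 else 0 := by
  rw [← Multiset.cons_zero, countVal_cons, countVal, Multiset.countP_zero, zero_add]

/-- The arithmetic relations between the signatures `s` of the source and `t` of the target of a
minimal holomorphic map. -/
structure SignatureMap (s t : Multiset ℕ) : Prop where
  exists_dvd : ∀ n ∈ s, ∃ m ∈ t, n ∣ m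
  countVal_le : ∀ p a b : ℕ, p.Prime → 1 ≤ a → 1 ≤ b → (∀ n ∈ t, n.factorization p ≤ a) →
    countVal s p a = 1 → countVal t p b ≤ countVal s p b
  countVal_two : ∃ d, ∀ a, 1 ≤ a → (∀ n ∈ t, n.factorization 2 ≤ a) →
    countVal s 2 a ≡ countVal t 2 a * d [MOD 2]

theorem IsMinimal.signatureMap {O₁ O₂ : SphereOrbifold} {f : RatFunc ℂ}
    (h : IsMinimal f O₁ O₂) : SignatureMap O₁.signature O₂.signature where
  exists_dvd := h.exists_dvd
  countVal_le _ _ _ hp ha hb htop hone := h.countVal_le hp ha htop hone hb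
  countVal_two := ⟨RatMap.deg f, fun _ ha htop => h.countVal_two_modEq ha htop⟩


theorem exists_prime_factorization_lt {m n : ℕ} (hn : n ≠ 0) (h : m ∣ n) (hne : m ≠ n) :
    ∃ p, p.Prime ∧ p ∣ n ∧ m.factorization p < n.factorization p := by
  have hm : m ≠ 0 := ne_zero_of_dvd_ne_zero hn h
  have hle := (Nat.factorization_le_iff_dvd hm hn).mpr h
  by_contra! hcon
  refine hne (Nat.eq_of_factorization_eq hm hn fun p => le_antisymm (hle p) ?_)
  by_cases hp : p.Prime ∧ p ∣ n
  · exact hcon p hp.1 hp.2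
  · have : n.factorization p = 0 := by
      rw [Nat.factorization_eq_zero_iff]
      tauto
    rw [this]
    exact Nat.zero_le _

/-- Rigidity of the signature `{n, n}`. The entries of `t` divide `n` and `n` is one of them. A
single entry, or a second one different from `n`, contradicts `countVal_le` for a prime whose power
in `n` occurs only once in `t`, and `{2, 2, n}` contradicts `countVal_two`. -/
theorem SignatureMap.eq_pair {t : Multiset ℕ} {n : ℕ} (hn : 2 ≤ n) (ht : ∀ m ∈ t, 2 ≤ m)
    (hχ : 0 < eulerChar t) (hts : SignatureMap t {n, n}) (hst : SignatureMap {n, n} t) :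
    t = {n, n} := by
  have hdvd : ∀ m ∈ t, m ∣ n := fun m hm => by
    obtain ⟨k, hk, hmk⟩ := hts.exists_dvd m hm
    simp only [Multiset.insert_eq_cons, Multiset.mem_cons, Multiset.mem_singleton, or_self] at hk
    rwa [hk] at hmk
  have hmem : n ∈ t := by
    obtain ⟨m, hm, hnm⟩ := hst.exists_dvd n (by simp)
    rwa [Nat.dvd_antisymm hnm (hdvd m hm)]
  have htop : ∀ p, ∀ k ∈ ({n, n} : Multiset ℕ), k.factorization p ≤ n.factorization p := by
    intro p k hk
    simp only [Multiset.insert_eq_cons, Multiset.mem_cons, Multiset.mem_singleton, or_self] at hk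
    rw [hk]
  have hone : ∀ p, p.Prime → p ∣ n → countVal t p (n.factorization p) ≠ 1 := by
    intro p hp hpn h1
    have ha := (hp.dvd_iff_one_le_factorization (by omega)).mp hpn
    have := hts.countVal_le p _ _ hp ha ha (htop p) h1
    simp [countVal_cons, countVal_singleton, h1] at this
  have hpair : ∀ m, m ∣ n → t = {n, m} → m = n := by
    intro m hm hmt
    by_contra hne
    obtain ⟨p, hp, hpn, hlt⟩ := exists_prime_factorization_lt (by omega) hm hne
    refine hone p hp hpn ?_
    rw [hmt, Multiset.insert_eq_cons, countVal_cons, countVal_singleton, if_pos rfl,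
      if_neg hlt.ne]
  rcases signature_classification ht hχ.le with ⟨-, h⟩ | ⟨h, -⟩
  · rcases h with rfl | ⟨k, rfl⟩ | ⟨x, y, rfl⟩ | ⟨k, rfl⟩ | h
    · simp at hmem
    · rw [Multiset.mem_singleton] at hmem
      subst hmem
      exact absurd (by rw [countVal_singleton, if_pos rfl])
        (hone _ (Nat.minFac_prime (by omega)) (Nat.minFac_dvd n))
    · simp only [Multiset.insert_eq_cons, Multiset.mem_cons, Multiset.mem_singleton] at hmem
      rcases hmem with rfl | rfl
      · rw [hpair y (hdvd y (by simp)) rfl]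
      · rw [hpair x (hdvd x (by simp)) (Multiset.pair_comm x n), Multiset.pair_comm]
    · -- three points cannot be distributed over two fibres of the same parity
      have hk : k = n := by
        have h1 := hdvd k (by simp)
        simp only [Multiset.insert_eq_cons, Multiset.mem_cons, Multiset.mem_singleton] at hmem
        rcases hmem with rfl | rfl | rfl
        · have h2 := ht k (by simp)
          exact le_antisymm (Nat.le_of_dvd (by norm_num) h1) h2
        · have h2 := ht k (by simp)
          exact le_antisymm (Nat.le_of_dvd (by norm_num) h1) h2
        · rfl
      subst hk
      have ha := (Nat.prime_two.dvd_iff_one_le_factorization (by omega)).mp (hdvd 2 (by simp))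
      obtain ⟨d, hd⟩ := hts.countVal_two
      have := hd _ ha (htop 2)
      simp only [Multiset.insert_eq_cons, countVal_cons, countVal_singleton, if_true,
        Nat.ModEq] at this
      omega
    · have h2 : 2 ∣ n := hdvd 2 (by rcases h with rfl | rfl | rfl <;> simp)
      have h3 : 3 ∣ n := hdvd 3 (by rcases h with rfl | rfl | rfl <;> simp)
      rcases h with rfl | rfl | rfl <;>
        simp only [Multiset.insert_eq_cons, Multiset.mem_cons, Multiset.mem_singleton] at hmem <;>
        omega
  · exact absurd h hχ.ne'

/-- Rigidity of the signature `{2, 2, n}`. The alternatives `{n}`, `{n, m}` and, for `n = 3`,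
`{2, 3, 3}` are excluded by the prime `2`. For even `n` and `m` of the same `2`-adic valuation as
`n` the contradiction comes from the map from `{2, 2, n}` to `{n, m}`, since `z + 1 / z` maps `{n, n}`
minimally to `{2, 2, n}`. -/
theorem SignatureMap.eq_two_two {t : Multiset ℕ} {n : ℕ} (hn : 2 ≤ n) (ht : ∀ m ∈ t, 2 ≤ m)
    (hχ : 0 < eulerChar t) (hts : SignatureMap t {2, 2, n}) (hst : SignatureMap {2, 2, n} t) :
    t = {2, 2, n} := by
  have hdvd : ∀ m ∈ t, m = 2 ∨ m ∣ n := fun m hm => by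
    obtain ⟨k, hk, hmk⟩ := hts.exists_dvd m hm
    simp only [Multiset.insert_eq_cons, Multiset.mem_cons, Multiset.mem_singleton] at hk
    have h2 : m ∣ 2 → m = 2 := fun h => le_antisymm (Nat.le_of_dvd (by norm_num) h) (ht m hm)
    rcases hk with rfl | rfl | rfl
    exacts [Or.inl (h2 hmk), Or.inl (h2 hmk), Or.inr hmk]
  have hmem : n ∈ t := by
    obtain ⟨m, hm, hnm⟩ := hst.exists_dvd n (by simp)
    rcases hdvd m hm with rfl | h
    · rwa [le_antisymm (Nat.le_of_dvd (by norm_num) hnm) hn]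
    · rwa [Nat.dvd_antisymm hnm h]
  obtain ⟨e, he, h2e⟩ := hst.exists_dvd 2 (by simp)
  have h22 : Nat.factorization 2 2 = 1 := Nat.prime_two.factorization_self
  -- the largest `2`-adic valuation does not occur just once in `t`
  have hone : ∀ a, 1 ≤ a → (∀ k ∈ ({2, 2, n} : Multiset ℕ), k.factorization 2 ≤ a) →
      countVal t 2 1 ≤ 1 → countVal t 2 a ≠ 1 := by
    intro a ha htop hle h1
    have := hts.countVal_le 2 a 1 Nat.prime_two ha le_rfl htop h1
    simp only [Multiset.insert_eq_cons, countVal_cons, countVal_singleton, h22, if_true] at this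
    omega
  have htop_even : 2 ∣ n → 1 ≤ n.factorization 2 ∧
      ∀ k ∈ ({2, 2, n} : Multiset ℕ), k.factorization 2 ≤ n.factorization 2 := by
    intro h
    have ha := (Nat.prime_two.dvd_iff_one_le_factorization (by omega)).mp h
    refine ⟨ha, fun k hk => ?_⟩
    simp only [Multiset.insert_eq_cons, Multiset.mem_cons, Multiset.mem_singleton] at hk
    rcases hk with rfl | rfl | rfl
    exacts [h22.trans_le ha, h22.trans_le ha, le_rfl]
  have htop_odd : ¬ 2 ∣ n → n.factorization 2 = 0 ∧
      ∀ k ∈ ({2, 2, n} : Multiset ℕ), k.factorization 2 ≤ 1 := by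
    intro h
    have ha := Nat.factorization_eq_zero_of_not_dvd h
    refine ⟨ha, fun k hk => ?_⟩
    simp only [Multiset.insert_eq_cons, Multiset.mem_cons, Multiset.mem_singleton] at hk
    rcases hk with rfl | rfl | rfl
    exacts [h22.le, h22.le, ha.trans_le zero_le_one]
  have hpair : ∀ m, t = {n, m} → False := by
    intro m hmt
    subst hmt
    have hm2 := ht m (by simp)
    by_cases hn2 : 2 ∣ n
    · obtain ⟨ha, htop⟩ := htop_even hn2
      have hmn : m ∣ n := by
        rcases hdvd m (by simp) with rfl | h
        exacts [hn2, h]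
      have hle := (Nat.factorization_le_iff_dvd (by omega) (by omega)).mpr hmn 2
      rcases hle.lt_or_eq with hlt | heq
      · refine hone _ ha htop ?_ ?_
        · simp only [Multiset.insert_eq_cons, countVal_cons, countVal_singleton]
          split_ifs <;> omega
        · simp only [Multiset.insert_eq_cons, countVal_cons, countVal_singleton, if_true]
          rw [if_neg hlt.ne]
      · -- both entries of `t` have the top valuation: the reverse map has the wrong parity
        obtain ⟨d, hd⟩ := hst.countVal_two
        have := hd _ ha (by
          intro k hk
          simp only [Multiset.insert_eq_cons, Multiset.mem_cons, Multiset.mem_singleton] at hk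
          rcases hk with rfl | rfl
          exacts [le_rfl, heq.le])
        simp only [Multiset.insert_eq_cons, countVal_cons, countVal_singleton, heq, if_true,
          Nat.ModEq] at this
        omega
    · obtain ⟨ha, htop⟩ := htop_odd hn2
      have hm : m = 2 := by
        simp only [Multiset.insert_eq_cons, Multiset.mem_cons, Multiset.mem_singleton] at he
        rcases he with rfl | rfl
        · exact absurd h2e hn2
        · rcases hdvd e (by simp) with h | h
          exacts [h, absurd (h2e.trans h) hn2]
      subst hm
      have hcount : countVal {n, 2} 2 1 = 1 := by
        simp only [Multiset.insert_eq_cons, countVal_cons, countVal_singleton, h22, ha, if_true]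
        rfl
      exact hone 1 le_rfl htop hcount.le hcount
  rcases signature_classification ht hχ.le with ⟨-, h⟩ | ⟨h, -⟩
  · rcases h with rfl | ⟨k, rfl⟩ | ⟨x, y, rfl⟩ | ⟨k, rfl⟩ | h
    · simp at hmem
    · rw [Multiset.mem_singleton] at hmem he
      subst hmem he
      obtain ⟨ha, htop⟩ := htop_even h2e
      refine absurd (by rw [countVal_singleton, if_pos rfl]) (hone _ ha htop ?_)
      rw [countVal_singleton]
      split_ifs <;> omega
    · simp only [Multiset.insert_eq_cons, Multiset.mem_cons, Multiset.mem_singleton] at hmem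
      rcases hmem with rfl | rfl
      · exact (hpair y rfl).elim
      · exact (hpair x (Multiset.pair_comm x n)).elim
    · simp only [Multiset.insert_eq_cons, Multiset.mem_cons, Multiset.mem_singleton] at hmem
      have hk := ht k (by simp)
      have : k = n := by
        rcases hmem with rfl | rfl | rfl
        · rcases hdvd k (by simp) with h | h
          exacts [h, le_antisymm (Nat.le_of_dvd (by norm_num) h) hk]
        · rcases hdvd k (by simp) with h | h
          exacts [h, le_antisymm (Nat.le_of_dvd (by norm_num) h) hk]
        · rfl
      rw [this]
    · have h3 : 3 ∣ n := by
        rcases hdvd 3 (by rcases h with rfl | rfl | rfl <;> simp) with h | h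
        · omega
        · exact h
      rcases h with rfl | rfl | rfl <;>
        simp only [Multiset.insert_eq_cons, Multiset.mem_cons, Multiset.mem_singleton] at hmem
      · obtain rfl : n = 3 := by omega
        obtain ⟨ha, htop⟩ := htop_odd (by norm_num)
        have hcount : countVal {2, 3, 3} 2 1 = 1 := by
          simp only [Multiset.insert_eq_cons, countVal_cons, countVal_singleton, h22, ha, if_true]
          rfl
        exact absurd hcount (hone 1 le_rfl htop hcount.le)
      · have := hdvd 4 (by simp)
        omega
      · have := hdvd 5 (by simp)
        omega
  · exact absurd h hχ.ne'

/-- Rigidity of the signature `{2, 3, 3}`: a single entry `3` in `t` contradicts `countVal_le` for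
the prime `3`. -/
theorem SignatureMap.eq_two_three_three {t : Multiset ℕ} (ht : ∀ m ∈ t, 2 ≤ m)
    (hχ : 0 < eulerChar t) (hts : SignatureMap t {2, 3, 3}) (hst : SignatureMap {2, 3, 3} t) :
    t = {2, 3, 3} := by
  have hdvd : ∀ m ∈ t, m = 2 ∨ m = 3 := fun m hm => by
    obtain ⟨k, hk, hmk⟩ := hts.exists_dvd m hm
    simp only [Multiset.insert_eq_cons, Multiset.mem_cons, Multiset.mem_singleton, or_self] at hk
    have h2 := ht m hm
    rcases hk with rfl | rfl
    · exact Or.inl (le_antisymm (Nat.le_of_dvd (by norm_num) hmk) h2)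
    · have := Nat.le_of_dvd (by norm_num) hmk
      omega
  have hmem : ∀ p, p = 2 ∨ p = 3 → p ∈ t := fun p hp => by
    obtain ⟨m, hm, hpm⟩ := hst.exists_dvd p (by rcases hp with rfl | rfl <;> simp)
    have : p = m := by
      rcases hdvd m hm with rfl | rfl <;> rcases hp with rfl | rfl <;> omega
    rwa [this]
  have h2mem := hmem 2 (Or.inl rfl)
  have h3mem := hmem 3 (Or.inr rfl)
  have h33 : Nat.factorization 3 3 = 1 := Nat.prime_three.factorization_self
  have h23 : Nat.factorization 2 3 = 0 := Nat.factorization_eq_zero_of_not_dvd (by norm_num)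
  have hone : countVal t 3 1 ≠ 1 := by
    intro h1
    have := hts.countVal_le 3 1 1 Nat.prime_three le_rfl le_rfl (by simp [h33, h23]) h1
    simp [countVal_cons, countVal_singleton, h1, h33, h23] at this
  rcases signature_classification ht hχ.le with ⟨-, h⟩ | ⟨h, -⟩
  · rcases h with rfl | ⟨k, rfl⟩ | ⟨x, y, rfl⟩ | ⟨k, rfl⟩ | rfl | rfl | rfl
    · simp at h2mem
    · simp only [Multiset.mem_singleton] at h2mem h3mem
      omega
    · rcases hdvd x (by simp) with rfl | rfl <;> rcases hdvd y (by simp) with rfl | rfl <;>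
        simp [countVal_cons, countVal_singleton, h33, h23] at hone h2mem h3mem
    · obtain rfl : k = 3 := by
        simp only [Multiset.insert_eq_cons, Multiset.mem_cons, Multiset.mem_singleton] at h3mem
        omega
      simp [countVal_cons, countVal_singleton, h33, h23] at hone
    · rfl
    · have := hdvd 4 (by simp)
      omega
    · have := hdvd 5 (by simp)
      omega
  · exact absurd h hχ.ne'

/-- Rigidity of the signature `{2, 3, 4}`: the alternative `{3, 4}` contradicts `countVal_le` for
the prime `2`. -/
theorem SignatureMap.eq_two_three_four {t : Multiset ℕ} (ht : ∀ m ∈ t, 2 ≤ m)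
    (hχ : 0 < eulerChar t) (hts : SignatureMap t {2, 3, 4}) (hst : SignatureMap {2, 3, 4} t) :
    t = {2, 3, 4} := by
  have hdvd : ∀ m ∈ t, m = 2 ∨ m = 3 ∨ m = 4 := fun m hm => by
    obtain ⟨k, hk, hmk⟩ := hts.exists_dvd m hm
    simp only [Multiset.insert_eq_cons, Multiset.mem_cons, Multiset.mem_singleton] at hk
    have h2 := ht m hm
    rcases hk with rfl | rfl | rfl <;>
      have := Nat.le_of_dvd (by norm_num) hmk <;> omega
  have hmem : ∀ p, p = 3 ∨ p = 4 → p ∈ t := fun p hp => by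
    obtain ⟨m, hm, hpm⟩ := hst.exists_dvd p (by rcases hp with rfl | rfl <;> simp)
    have : p = m := by
      rcases hdvd m hm with rfl | rfl | rfl <;> rcases hp with rfl | rfl <;> omega
    rwa [this]
  have h3mem := hmem 3 (Or.inl rfl)
  have h4mem := hmem 4 (Or.inr rfl)
  have h22 : Nat.factorization 2 2 = 1 := Nat.prime_two.factorization_self
  have h32 : Nat.factorization 3 2 = 0 := Nat.factorization_eq_zero_of_not_dvd (by norm_num)
  have h42 : Nat.factorization 4 2 = 2 := Nat.prime_two.factorization_pow (k := 2) ▸ by simp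
  -- the entry `2` of `{2, 3, 4}` requires an entry of `2`-adic valuation one in `t`
  have hone : countVal t 2 2 = 1 → 1 ≤ countVal t 2 1 := by
    intro h1
    have := hts.countVal_le 2 2 1 Nat.prime_two one_le_two le_rfl (by simp [h22, h32, h42]) h1
    simpa [countVal_cons, countVal_singleton, h22, h32, h42] using this
  rcases signature_classification ht hχ.le with ⟨-, h⟩ | ⟨h, -⟩
  · rcases h with rfl | ⟨k, rfl⟩ | ⟨x, y, rfl⟩ | ⟨k, rfl⟩ | rfl | rfl | rfl
    · simp at h3mem
    · simp only [Multiset.mem_singleton] at h3mem h4mem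
      omega
    · simp only [Multiset.insert_eq_cons, Multiset.mem_cons, Multiset.mem_singleton] at h3mem h4mem
      have hxy : x = 3 ∧ y = 4 ∨ x = 4 ∧ y = 3 := by omega
      rcases hxy with ⟨rfl, rfl⟩ | ⟨rfl, rfl⟩ <;>
        simp [countVal_cons, countVal_singleton, h32, h42] at hone
    · simp only [Multiset.insert_eq_cons, Multiset.mem_cons, Multiset.mem_singleton] at h3mem h4mem
      omega
    · simp at h4mem
    · rfl
    · simp at h4mem
  · exact absurd h hχ.ne'

/-- Rigidity of the signature `{2, 3, 5}`: all three entries have to occur in `t`. -/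
theorem SignatureMap.eq_two_three_five {t : Multiset ℕ} (ht : ∀ m ∈ t, 2 ≤ m)
    (hχ : 0 < eulerChar t) (hts : SignatureMap t {2, 3, 5}) (hst : SignatureMap {2, 3, 5} t) :
    t = {2, 3, 5} := by
  have hdvd : ∀ m ∈ t, m = 2 ∨ m = 3 ∨ m = 5 := fun m hm => by
    obtain ⟨k, hk, hmk⟩ := hts.exists_dvd m hm
    simp only [Multiset.insert_eq_cons, Multiset.mem_cons, Multiset.mem_singleton] at hk
    have h2 := ht m hm
    have hk' : k.Prime := by rcases hk with rfl | rfl | rfl <;> norm_num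
    have := (Nat.dvd_prime hk').mp hmk
    omega
  have hmem : ∀ p, p = 2 ∨ p = 3 ∨ p = 5 → p ∈ t := fun p hp => by
    obtain ⟨m, hm, hpm⟩ := hst.exists_dvd p (by rcases hp with rfl | rfl | rfl <;> simp)
    have : p = m := by
      rcases hdvd m hm with rfl | rfl | rfl <;> rcases hp with rfl | rfl | rfl <;>
        omega
    rwa [this]
  have h2mem := hmem 2 (by simp)
  have h3mem := hmem 3 (by simp)
  have h5mem := hmem 5 (by simp)
  rcases signature_classification ht hχ.le with ⟨-, h⟩ | ⟨h, -⟩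
  · rcases h with rfl | ⟨k, rfl⟩ | ⟨x, y, rfl⟩ | ⟨k, rfl⟩ | rfl | rfl | rfl <;>
      simp only [Multiset.insert_eq_cons, Multiset.mem_cons, Multiset.mem_singleton,
        Multiset.notMem_zero] at h2mem h3mem h5mem <;> first | rfl | omega
  · exact absurd h hχ.ne'

/-- Two signatures of nonnegative Euler characteristic that map to each other agree, if one of
them is good. -/
theorem SignatureMap.eq {s t : Multiset ℕ} (hs : ∀ n ∈ s, 2 ≤ n) (ht : ∀ n ∈ t, 2 ≤ n)
    (hs0 : 0 ≤ eulerChar s) (ht0 : 0 ≤ eulerChar t) (hiff : 0 < eulerChar s ↔ 0 < eulerChar t)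
    (hone : ∀ n, s ≠ {n}) (htwo : ∀ m n, s = {m, n} → m = n)
    (hts : SignatureMap t s) (hst : SignatureMap s t) : t = s := by
  rcases signature_classification hs hs0 with ⟨hpos, h⟩ | ⟨hzero, h⟩
  · have htpos := hiff.mp hpos
    rcases h with rfl | ⟨n, rfl⟩ | ⟨m, n, rfl⟩ | ⟨n, rfl⟩ | rfl | rfl | rfl
    · refine Multiset.eq_zero_of_forall_notMem fun n hn => ?_
      obtain ⟨m, hm, -⟩ := hts.exists_dvd n hn
      simp at hm
    · exact absurd rfl (hone n)
    · obtain rfl := htwo m n rfl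
      exact SignatureMap.eq_pair (hs m (by simp)) ht htpos hts hst
    · exact SignatureMap.eq_two_two (hs n (by simp)) ht htpos hts hst
    · exact SignatureMap.eq_two_three_three ht htpos hts hst
    · exact SignatureMap.eq_two_three_four ht htpos hts hst
    · exact SignatureMap.eq_two_three_five ht htpos hts hst
  · have htzero : eulerChar t = 0 := by
      rw [hzero] at hiff
      exact le_antisymm (not_lt.mp fun h => lt_irrefl _ (hiff.mpr h)) ht0
    rcases signature_classification ht ht0 with ⟨h', -⟩ | ⟨-, h'⟩
    · exact absurd htzero h'.ne'
    · -- in each of the four signatures the greatest entry is a multiple of all the others, and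
      -- these greatest entries are different
      have h1 := hts.exists_dvd
      have h2 := hst.exists_dvd
      rcases h with rfl | rfl | rfl | rfl <;> rcases h' with rfl | rfl | rfl | rfl <;>
        first
        | rfl
        | (simp at h1; done)
        | simp at h2

/-- An orbifold with a pair of minimal maps back and forth, of degrees at least two, has
nonnegative Euler characteristic. -/
theorem eulerChar_nonneg_of_isMinimal {O O' : SphereOrbifold} {U V : RatFunc ℂ}
    (hdU : 2 ≤ RatMap.deg U) (hdV : 2 ≤ RatMap.deg V) (hU : IsMinimal U O' O)
    (hV : IsMinimal V O O') : 0 ≤ eulerChar O.signature := by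
  have h1 := hU.eulerChar_le
  have h2 := hV.eulerChar_le
  have hdU' : (2 : ℚ) ≤ RatMap.deg U := by exact_mod_cast hdU
  have hdV' : (2 : ℚ) ≤ RatMap.deg V := by exact_mod_cast hdV
  have h3 := h2.trans (mul_le_mul_of_nonneg_left h1 (by linarith))
  have h4 : 1 < (RatMap.deg V : ℚ) * RatMap.deg U := by nlinarith
  by_contra! hneg
  nlinarith

/-- The signature of the intermediate orbifold of a decomposition of a minimal self-map of a good
orbifold. -/
theorem signature_eq_of_isMinimal {O O' : SphereOrbifold} (hO : O.IsGood) {U V : RatFunc ℂ}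
    (hdU : 2 ≤ RatMap.deg U) (hdV : 2 ≤ RatMap.deg V) (hU : IsMinimal U O' O)
    (hV : IsMinimal V O O') : O'.signature = O.signature := by
  have h1 := hU.eulerChar_le
  have h2 := hV.eulerChar_le
  have hd0 : (0 : ℚ) < RatMap.deg U := by exact_mod_cast hU.1
  have he0 : (0 : ℚ) < RatMap.deg V := by exact_mod_cast hV.1
  have hs0 := eulerChar_nonneg_of_isMinimal hdU hdV hU hV
  refine SignatureMap.eq (fun _ => two_le_of_mem_signature) (fun _ => two_le_of_mem_signature)
    hs0 (nonneg_of_mul_nonneg_right (hs0.trans h2) he0)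
    ⟨fun h => pos_of_mul_pos_right (h.trans_le h2) he0.le,
      fun h => pos_of_mul_pos_right (h.trans_le h1) hd0.le⟩
    ?_ ?_ hU.signatureMap hV.signatureMap
  · intro n hn
    have hcard : O.finite.toFinset.card = 1 := by
      have := congrArg Multiset.card hn
      simpa [signature] using this
    obtain ⟨z, hz⟩ := Finset.card_eq_one.mp hcard
    refine hO.1 z ?_
    rw [sing, ← O.finite.coe_toFinset, hz, Finset.coe_singleton]
  · intro m n hmn
    have hcard : O.finite.toFinset.card = 2 := by
      have := congrArg Multiset.card hmn
      simpa [signature] using this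
    classical
    obtain ⟨z, w, hzw, hS⟩ := Finset.card_eq_two.mp hcard
    have hν := hO.2 z w hzw (by rw [sing, ← O.finite.coe_toFinset, hS, Finset.coe_pair])
    have hall : ∀ k ∈ O.signature, k = O.ν z := by
      intro k hk
      rw [signature, hS] at hk
      simp only [Multiset.mem_map, Finset.mem_val, Finset.mem_insert, Finset.mem_singleton] at hk
      obtain ⟨y, rfl | rfl, rfl⟩ := hk
      exacts [rfl, hν.symm]
    rw [hall m (by simp [hmn]), hall n (by simp [hmn])]

end SphereOrbifold

namespace RatMap

/-! ### Möbius transformations -/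

theorem moebius_eq_div (M : GL (Fin 2) ℂ) : moebius M =
    algebraMap ℂ[X] (RatFunc ℂ) (C (M 0 0) * X + C (M 0 1)) /
      algebraMap ℂ[X] (RatFunc ℂ) (C (M 1 0) * X + C (M 1 1)) := by
  simp [moebius, RatFunc.algebraMap_X]

theorem row_ne_zero (M : GL (Fin 2) ℂ) (i : Fin 2) : M i 0 ≠ 0 ∨ M i 1 ≠ 0 := by
  by_contra! h
  refine M.det_ne_zero ?_
  rw [Matrix.det_fin_two]
  fin_cases i <;> simp_all

theorem moebius_row_ne_zero (M : GL (Fin 2) ℂ) (i : Fin 2) :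
    (C (M i 0) * X + C (M i 1) : ℂ[X]) ≠ 0 := by
  intro h
  have h0 := congrArg (fun p => coeff p 0) h
  have h1 := congrArg (fun p => coeff p 1) h
  simp at h0 h1
  rcases row_ne_zero M i with h | h
  exacts [h h1, h h0]

open Classical in
/-- The Möbius transformation of a matrix acts on the sphere by the action of `GL₂`. -/
theorem val_moebius (M : GL (Fin 2) ℂ) (z : Sphere) : val (moebius M) z = M • z := by
  have hdet : M 0 0 * M 1 1 - M 0 1 * M 1 0 ≠ 0 := by
    rw [← Matrix.det_fin_two]
    exact M.det_ne_zero
  have hne : moebius M ≠ 0 := by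
    rw [moebius_eq_div]
    exact div_ne_zero (RatFunc.algebraMap_ne_zero (moebius_row_ne_zero M 0))
      (RatFunc.algebraMap_ne_zero (moebius_row_ne_zero M 1))
  induction z using OnePoint.rec with
  | infty =>
    rw [OnePoint.smul_infty_eq_ite]
    split_ifs with h
    · have h00 : M 0 0 ≠ 0 := fun h0 => hdet (by simp [h, h0])
      refine val_eq_infty hne (hasValue_infty.mpr ⟨_, _, moebius_row_ne_zero M 0,
        by rw [moebius_eq_div, inv_div], ?_, ?_⟩)
      · simp [h]
      · rw [natDegree_linear h00, leadingCoeff_linear h00]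
        simp [h]
    · refine (hasValue_infty.mpr ⟨_, _, moebius_row_ne_zero M 1, moebius_eq_div M, ?_, ?_⟩).val_eq
      · rw [natDegree_linear h]
        exact natDegree_linear_le
      · rw [natDegree_linear h, leadingCoeff_linear h]
        simp [h]
  | coe a =>
    rw [OnePoint.smul_some_eq_ite]
    split_ifs with h
    · have hnum : M 0 0 * a + M 0 1 ≠ 0 := by
        intro h0
        exact hdet (by linear_combination M 0 0 * h - M 1 0 * h0)
      exact val_eq_infty hne (hasValue_coe.mpr ⟨C (M 1 0) * X + C (M 1 1),
        C (M 0 0) * X + C (M 0 1), by simpa using hnum, by rw [moebius_eq_div, inv_div],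
        by simp [h]⟩)
    · refine (hasValue_coe.mpr ⟨C (M 0 0) * X + C (M 0 1),
        C (M 1 0) * X + C (M 1 1), by simpa using h, moebius_eq_div M, ?_⟩).val_eq
      simp [div_mul_cancel₀ _ h]

theorem deg_moebius_pos (M : GL (Fin 2) ℂ) : 0 < deg (moebius M) := by
  classical
  refine Nat.pos_of_ne_zero fun h => ?_
  obtain ⟨c, hc⟩ := (deg_eq_zero_iff _).mp h
  have hconst : ∀ z, M • z = (c : Sphere) := fun z => by
    rw [← val_moebius, hc, (hasValue_C z c).val_eq]
  have := MulAction.injective M ((hconst OnePoint.infty).trans (hconst (0 : ℂ)).symm)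
  exact OnePoint.infty_ne_coe _ this

theorem comp_moebius (M N : GL (Fin 2) ℂ) : comp (moebius M) (moebius N) = moebius (M * N) := by
  have hN := RatFunc.algebraMap_ne_zero (moebius_row_ne_zero N 1)
  rw [comp_eq_compHom _ _ (deg_moebius_pos N)]
  rw [moebius.eq_def M]
  simp only [map_div₀, map_add, map_mul, compHom_C, compHom_X]
  simp only [map_add, map_mul, RatFunc.algebraMap_C, RatFunc.algebraMap_X] at hN
  simp only [moebius]
  rw [← mul_div_mul_right _ _ hN]
  congr 1
  · rw [add_mul, mul_assoc, div_mul_cancel₀ _ hN]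
    simp [Matrix.mul_apply, Fin.sum_univ_two]
    ring
  · rw [add_mul, mul_assoc, div_mul_cancel₀ _ hN]
    simp [Matrix.mul_apply, Fin.sum_univ_two]
    ring

theorem localDeg_X (z : Sphere) : localDeg RatFunc.X z = 1 := by
  have hd : deg RatFunc.X = 1 := by simp [deg]
  induction z using OnePoint.rec with
  | infty =>
    have : val RatFunc.X OnePoint.infty = OnePoint.infty := by
      rw [val_infty_eq_infty_iff]
      simp
    rw [localDeg_infty, this, fiberPoly_infty, hd]
    simp
  | coe a =>
    have : val RatFunc.X (a : Sphere) = (a : Sphere) := by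
      rw [val_coe]
      simp
    rw [localDeg_coe, this, fiberPoly_coe]
    simpa using rootMultiplicity_X_sub_C_self (x := a)

theorem localDeg_moebius (M : GL (Fin 2) ℂ) (z : Sphere) : localDeg (moebius M) z = 1 := by
  have h := localDeg_comp (deg_moebius_pos M⁻¹) (deg_moebius_pos M) z
  have h1 : moebius 1 = RatFunc.X := by simp [moebius]
  rw [comp_moebius, inv_mul_cancel, h1, localDeg_X] at h
  exact Nat.eq_one_of_mul_eq_one_left h.symm

open Classical in
/-- The point of the sphere with homogeneous coordinates `(p : q)`. -/
noncomputable def ofHomogeneous (p q : ℂ) : Sphere :=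
  if q = 0 then OnePoint.infty else ((p / q : ℂ) : Sphere)

theorem ofHomogeneous_mul {k : ℂ} (hk : k ≠ 0) (p q : ℂ) :
    ofHomogeneous (k * p) (k * q) = ofHomogeneous p q := by
  simp only [ofHomogeneous, mul_eq_zero, hk, false_or, mul_div_mul_left _ _ hk]

/-- Homogeneous coordinates of a point of the sphere, normalized. -/
def homogeneous : Sphere → ℂ × ℂ
  | some a => (a, 1)
  | none => (1, 0)

theorem homogeneous_coe (a : ℂ) : homogeneous (a : Sphere) = (a, 1) := rfl

theorem homogeneous_infty : homogeneous OnePoint.infty = (1, 0) := rfl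

theorem ofHomogeneous_homogeneous (z : Sphere) :
    ofHomogeneous (homogeneous z).1 (homogeneous z).2 = z := by
  induction z using OnePoint.rec with
  | infty => simp [homogeneous_infty, ofHomogeneous]
  | coe a => simp [homogeneous_coe, ofHomogeneous]

theorem homogeneous_det_ne_zero {z w : Sphere} (h : z ≠ w) :
    (homogeneous z).1 * (homogeneous w).2 - (homogeneous w).1 * (homogeneous z).2 ≠ 0 := by
  induction z using OnePoint.rec with
  | infty =>
    induction w using OnePoint.rec with
    | infty => exact absurd rfl h
    | coe b => simp [homogeneous_coe, homogeneous_infty]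
  | coe a =>
    induction w using OnePoint.rec with
    | infty => simp [homogeneous_coe, homogeneous_infty]
    | coe b =>
      simp only [homogeneous_coe, mul_one, sub_ne_zero]
      rintro rfl
      exact h rfl

open Classical in
/-- The points `0`, `1`, `∞` can be moved to any three distinct points by a Möbius
transformation. -/
theorem exists_smul_zero_one_infty {x y z : Sphere} (hxy : x ≠ y) (hxz : x ≠ z) (hyz : y ≠ z) :
    ∃ M : GL (Fin 2) ℂ, M • ((0 : ℂ) : Sphere) = x ∧ M • ((1 : ℂ) : Sphere) = y ∧
      M • (OnePoint.infty : Sphere) = z := by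
  have h1 := homogeneous_det_ne_zero hxy.symm
  have h2 := homogeneous_det_ne_zero hyz.symm
  have h3 := homogeneous_det_ne_zero hxz.symm
  have hx := ofHomogeneous_homogeneous x
  have hy := ofHomogeneous_homogeneous y
  have hz := ofHomogeneous_homogeneous z
  -- the columns represent `z` and `x`, scaled so that their sum represents `y`
  set k := (homogeneous y).1 * (homogeneous x).2 - (homogeneous x).1 * (homogeneous y).2
  set l := (homogeneous z).1 * (homogeneous y).2 - (homogeneous y).1 * (homogeneous z).2
  set m := (homogeneous z).1 * (homogeneous x).2 - (homogeneous x).1 * (homogeneous z).2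
  let A : Matrix (Fin 2) (Fin 2) ℂ :=
    !![k * (homogeneous z).1, l * (homogeneous x).1; k * (homogeneous z).2, l * (homogeneous x).2]
  have hA : A.det ≠ 0 := by
    have : A.det = k * l * m := by
      rw [Matrix.det_fin_two_of]
      ring
    rw [this]
    exact mul_ne_zero (mul_ne_zero h1 h2) h3
  refine ⟨Matrix.GeneralLinearGroup.mkOfDetNeZero A hA, ?_, ?_, ?_⟩
  · rw [← hx, ← ofHomogeneous_mul h2, OnePoint.smul_some_eq_ite, ofHomogeneous]
    simp [Matrix.GeneralLinearGroup.mkOfDetNeZero, A]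
  · rw [← hy, ← ofHomogeneous_mul h3, OnePoint.smul_some_eq_ite, ofHomogeneous]
    have e1 : m * (homogeneous y).1 = k * (homogeneous z).1 + l * (homogeneous x).1 := by
      simp only [k, l, m]
      ring
    have e2 : m * (homogeneous y).2 = k * (homogeneous z).2 + l * (homogeneous x).2 := by
      simp only [k, l, m]
      ring
    rw [e1, e2]
    simp [Matrix.GeneralLinearGroup.mkOfDetNeZero, A]
  · rw [← hz, ← ofHomogeneous_mul h1, OnePoint.smul_infty_eq_ite, ofHomogeneous]
    simp [Matrix.GeneralLinearGroup.mkOfDetNeZero, A]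

open Classical in
/-- The Möbius group acts transitively on triples of distinct points of the sphere. -/
theorem exists_smul_triple {x y z x' y' z' : Sphere} (hxy : x ≠ y) (hxz : x ≠ z) (hyz : y ≠ z)
    (hxy' : x' ≠ y') (hxz' : x' ≠ z') (hyz' : y' ≠ z') :
    ∃ M : GL (Fin 2) ℂ, M • x = x' ∧ M • y = y' ∧ M • z = z' := by
  obtain ⟨M, rfl, rfl, rfl⟩ := exists_smul_zero_one_infty hxy hxz hyz
  obtain ⟨N, rfl, rfl, rfl⟩ := exists_smul_zero_one_infty hxy' hxz' hyz'
  exact ⟨N * M⁻¹, by rw [mul_smul, inv_smul_smul], by rw [mul_smul, inv_smul_smul],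
    by rw [mul_smul, inv_smul_smul]⟩

end RatMap

namespace SphereOrbifold

open RatMap

/-! ### Isomorphisms of orbifolds with at most three singular points -/

theorem ν_eq_one_of_notMem {O : SphereOrbifold} {T : Finset Sphere} (hT : O.finite.toFinset ⊆ T)
    {z : Sphere} (hz : z ∉ T) : O.ν z = 1 := by
  by_contra hne
  refine hz (hT ?_)
  rw [Set.Finite.mem_toFinset]
  exact lt_of_le_of_ne (O.one_le z) (Ne.symm hne)

/-- The singular points can be completed to three points, with known values of `ν`. -/
theorem exists_superset_card_three {O : SphereOrbifold} (h : O.signature.card ≤ 3) :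
    ∃ T : Finset Sphere, O.finite.toFinset ⊆ T ∧ T.card = 3 ∧
      T.val.map O.ν = O.signature + Multiset.replicate (3 - O.signature.card) 1 := by
  classical
  have hinf : Infinite Sphere := Infinite.of_injective _ (OnePoint.coe_injective (X := ℂ))
  have hcard : O.signature.card = O.finite.toFinset.card := by simp [signature]
  obtain ⟨T, hT, hT3⟩ := Infinite.exists_superset_card_eq O.finite.toFinset 3 (hcard ▸ h)
  refine ⟨T, hT, hT3, ?_⟩
  have hval : T.val = O.finite.toFinset.val + (T \ O.finite.toFinset).val := by
    rw [Finset.sdiff_val, add_tsub_cancel_of_le (Finset.val_le_iff.mpr hT)]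
  rw [hval, Multiset.map_add, signature]
  congr 1
  rw [Multiset.eq_replicate]
  refine ⟨?_, ?_⟩
  · rw [Multiset.card_map, Finset.card_val, Finset.card_sdiff_of_subset hT, hT3, Multiset.card_map,
      Finset.card_val]
  · intro n hn
    obtain ⟨z, hz, rfl⟩ := Multiset.mem_map.mp hn
    exact ν_eq_one_of_notMem subset_rfl (Finset.mem_sdiff.mp (Finset.mem_val.mp hz)).2

open Classical in
/-- Orbifolds with the same signature and at most three singular points are isomorphic. -/
theorem exists_smul_of_signature_eq {O O' : SphereOrbifold} (hsig : O'.signature = O.signature)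
    (h : O.signature.card ≤ 3) : ∃ M : GL (Fin 2) ℂ, ∀ z : Sphere, O'.ν (M • z) = O.ν z := by
  obtain ⟨T, hT, hT3, hTν⟩ := exists_superset_card_three h
  obtain ⟨T', hT', -, hTν'⟩ := exists_superset_card_three (O := O') (hsig ▸ h)
  rw [hsig, ← hTν] at hTν'
  obtain ⟨x, y, z, hxy, hxz, hyz, rfl⟩ := Finset.card_eq_three.mp hT3
  have hv : ({x, y, z} : Finset Sphere).val = x ::ₘ y ::ₘ {z} := by
    rw [Finset.insert_val_of_notMem (by simp [hxy, hxz]),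
      Finset.insert_val_of_notMem (by simp [hyz]), Finset.singleton_val]
  rw [hv, Multiset.map_cons, Multiset.map_cons, Multiset.map_singleton] at hTν'
  obtain ⟨x', hx', hνx, h1⟩ := (Multiset.map_eq_cons _ _ _ _).mpr hTν'
  obtain ⟨y', hy', hνy, h2⟩ := (Multiset.map_eq_cons _ _ _ _).mpr h1
  obtain ⟨z', hz', hνz⟩ := Multiset.map_eq_singleton.mp h2
  have hT'val : T'.val = x' ::ₘ y' ::ₘ {z'} := by
    rw [← hz', Multiset.cons_erase hy', Multiset.cons_erase hx']
  have hnodup := T'.nodup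
  rw [hT'val] at hnodup
  simp only [Multiset.nodup_cons, Multiset.mem_cons, Multiset.mem_singleton, not_or,
    Multiset.nodup_singleton, and_true] at hnodup
  have hmem : ∀ w, w ∈ T' ↔ w = x' ∨ w = y' ∨ w = z' := fun w => by
    rw [← Finset.mem_val, hT'val]
    simp
  obtain ⟨M, rfl, rfl, rfl⟩ := exists_smul_triple hxy hxz hyz hnodup.1.1 hnodup.1.2 hnodup.2
  refine ⟨M, fun w => ?_⟩
  by_cases hw : w ∈ ({x, y, z} : Finset Sphere)
  · simp only [Finset.mem_insert, Finset.mem_singleton] at hw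
    rcases hw with rfl | rfl | rfl
    exacts [hνx, hνy, hνz]
  · rw [ν_eq_one_of_notMem hT hw, ν_eq_one_of_notMem hT']
    rw [hmem]
    simpa using hw

theorem isMinimal_moebius {O O' : SphereOrbifold} {M : GL (Fin 2) ℂ}
    (h : ∀ z, O'.ν (val (moebius M) z) = O.ν z) : IsMinimal (moebius M) O O' := by
  refine ⟨deg_moebius_pos M, fun z => ?_⟩
  rw [localDeg_moebius, Nat.gcd_one_left, mul_one, h]

end SphereOrbifold

theorem mainTheorem4 (O : SphereOrbifold) (hO : O.IsGood) :
    (∀ U ∈ O.minimalSelfMaps, ∀ V ∈ O.minimalSelfMaps,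
      RatMap.comp U V ∈ O.minimalSelfMaps) ∧
    ∀ U V : RatFunc ℂ, 2 ≤ RatMap.deg U → 2 ≤ RatMap.deg V →
      RatMap.comp U V ∈ O.minimalSelfMaps →
        (O.pullback U).signature = O.signature ∧
        SphereOrbifold.IsMinimal V O (O.pullback U) ∧
        SphereOrbifold.IsMinimal U (O.pullback U) O ∧
        (O.signature ≠ {2, 2, 2, 2} →
          ∃ M : GL (Fin 2) ℂ,
            RatMap.comp U (RatMap.moebius M) ∈ O.minimalSelfMaps ∧
            RatMap.comp (RatMap.moebius M⁻¹) V ∈ O.minimalSelfMaps) := by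
  classical
  refine ⟨fun U hU V hV => SphereOrbifold.IsMinimal.comp hU hV, fun U V hdU hdV hUV => ?_⟩
  have hU := SphereOrbifold.isMinimal_pullback (by omega : 0 < RatMap.deg U) O
  have hV := SphereOrbifold.IsMinimal.of_comp (by omega) (by omega) hUV
  have hsig := SphereOrbifold.signature_eq_of_isMinimal hO hdU hdV hU hV
  refine ⟨hsig, hV, hU, fun hne => ?_⟩
  have hcard : O.signature.card ≤ 3 := by
    by_contra! hcard
    exact hne (SphereOrbifold.eq_two_two_two_two
      (fun _ => SphereOrbifold.two_le_of_mem_signature)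
      (SphereOrbifold.eulerChar_nonneg_of_isMinimal hdU hdV hU hV) hcard)
  obtain ⟨M, hM⟩ := SphereOrbifold.exists_smul_of_signature_eq hsig hcard
  refine ⟨M, hU.comp (SphereOrbifold.isMinimal_moebius fun z => ?_),
    (SphereOrbifold.isMinimal_moebius fun z => ?_).comp hV⟩
  · rw [RatMap.val_moebius, hM]
  · rw [RatMap.val_moebius, ← hM, smul_inv_smul]
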